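/- Let $G$ be a finite simple undirected graph with vertex set $\mathsf V$ and non-empty edge set $\mathsf E$. Each edge $\mathsf e$ has a length $\ell_{\mathsf e}\in(0,\infty)$ and is identified with $[0,\ell_{\mathsf e}]$; $\mathsf E_{\mathsf v}$ denotes the set of edges incident to $\mathsf v\in\mathsf V$. Let $c_{\mathsf e}\in C[0,\ell_{\mathsf e}]$ and $p_{\mathsf e}\in L^\infty(0,\ell_{\mathsf e})$ be real-valued functions such that, for some constant $c_0>0$ and all $\mathsf e\in\mathsf E$, $c_{\mathsf e}(x)\ge c_0$ and $p_{\mathsf e}(x)\ge 0$ for almost all $x\in(0,\ell_{\mathsf e})$. On the real Hilbert space $\mathcal H=\prod_{\mathsf e\in\mathsf E}L^2(0,\ell_{\mathsf e})$ let $A$ be the operator $$Au=\big((c_{\mathsf e}u_{\mathsf e}')'-p_{\mathsf e}u_{\mathsf e}\big)_{\mathsf e\in\mathsf E},$$ whose domain $D(A)$ consists of all $u=(u_{\mathsf e})_{\mathsf e\in\mathsf E}$ such that $u_{\mathsf e}\in H^1(0,\ell_{\mathsf e})$ and $c_{\mathsf e}u_{\mathsf e}'\in H^1(0,\ell_{\mathsf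 e})$ for every $\mathsf e$, and such that at every vertex $\mathsf v$ the values $u_{\mathsf e}(\mathsf v)$, $\mathsf e\in\mathsf E_{\mathsf v}$, coincide and $\sum_{\mathsf e\in\mathsf E_{\mathsf v}}c_{\mathsf e}(\mathsf v)\,u_{\mathsf e}'(\mathsf v)=0$, where $u_{\mathsf e}'(\mathsf v)$ is the derivative at $\mathsf v$ in the direction from $\mathsf v$ into the edge $\mathsf e$. (If the $c_{\mathsf e}$ are continuously differentiable, the two edge conditions together say $u_{\mathsf e}\in H^2(0,\ell_{\mathsf e})$.) Then there exist a non-increasing real sequence $(\lambda_k)_{k\ge 1}$ and a complete orthonormal system $(f_k)_{k\ge 1}$ of $\mathcal H$ with $f_k\in D(A)$ and $Af_k=\lambda_kf_k$ for all $k\ge 1$; that is, $(\lambda_k)$ is the sequence of eigenvalues of $A$ repeated according to multiplicity. Moreover, for every such sequence $(\lambda_k)$ and every $\lambda>0$ there exist constants $l_1,l_2>0$ such that $$l_1k^2\le\lambda-\lambda_k\le l_2k^2\qquad\text{for all }k\ge 1.$$ -/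

import Mathlib

open MeasureTheory Set

/-- A compact metric graph carried by the simple graph `G`: every edge `e` has a positive finite
length `ℓ_e` and is identified with the interval `[0, ℓ_e]`, the coordinate `0` being the end point
`src e` and the coordinate `ℓ_e` being the end point `tgt e`. -/
structure MetricGraph {V : Type*} (G : SimpleGraph V) where
  src : G.edgeSet → V
  tgt : G.edgeSet → V
  ends : ∀ e : G.edgeSet, s(src e, tgt e) = (e : Sym2 V)
  length : G.edgeSet → ℝ
  length_pos : ∀ e, 0 < length e

/-- `u` is (the continuous representative of) an element of the Sobolev space `H¹(0, ℓ)` with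
derivative `u'`: it is absolutely continuous on `[0, ℓ]` with square integrable derivative `u'`. -/
def IsH1 (l : ℝ) (u u' : ℝ → ℝ) : Prop :=
  MemLp u' 2 (volume.restrict (Ioo 0 l)) ∧
    ∀ x ∈ Icc 0 l, u x = u 0 + ∫ t in (0 : ℝ)..x, u' t

theorem IsH1.intervalIntegrable {l : ℝ} {u u' : ℝ → ℝ} (h : IsH1 l u u') {x : ℝ}
    (hx : x ∈ Icc 0 l) : IntervalIntegrable u' volume 0 x := by
  rw [intervalIntegrable_iff_integrableOn_Ioo_of_le hx.1]
  have h1 : IntegrableOn u' (Ioo 0 l) := h.1.integrable (by norm_num)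
  exact h1.mono_set (Ioo_subset_Ioo_right hx.2)

theorem IsH1.zero (l : ℝ) : IsH1 l 0 0 := by
  refine ⟨MemLp.zero, fun x _ => ?_⟩
  simp

theorem IsH1.add {l : ℝ} {u u' v v' : ℝ → ℝ} (hu : IsH1 l u u') (hv : IsH1 l v v') :
    IsH1 l (u + v) (u' + v') := by
  refine ⟨hu.1.add hv.1, fun x hx => ?_⟩
  have h := intervalIntegral.integral_add (hu.intervalIntegrable hx) (hv.intervalIntegrable hx)
  simp only [Pi.add_apply]
  rw [h, hu.2 x hx, hv.2 x hx]
  ring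

theorem IsH1.smul {l : ℝ} {u u' : ℝ → ℝ} (a : ℝ) (hu : IsH1 l u u') :
    IsH1 l (a • u) (a • u') := by
  refine ⟨hu.1.const_smul a, fun x hx => ?_⟩
  simp only [Pi.smul_apply, smul_eq_mul, intervalIntegral.integral_const_mul]
  rw [hu.2 x hx]
  ring

theorem IsH1.continuousOn {l : ℝ} {u u' : ℝ → ℝ} (hu : IsH1 l u u') :
    ContinuousOn u (Icc 0 l) := by
  rcases lt_or_ge l 0 with hl | hl
  · rw [Icc_eq_empty (not_le.mpr hl)]
    exact continuousOn_empty _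
  · have h1 : IntegrableOn u' (uIcc 0 l) := by
      rw [uIcc_of_le hl, integrableOn_Icc_iff_integrableOn_Ioo]
      exact hu.1.integrable (by norm_num)
    have h2 := intervalIntegral.continuousOn_primitive_interval h1
    rw [uIcc_of_le hl] at h2
    exact (continuousOn_const.add h2).congr hu.2

theorem IsH1.ae_hasDerivAt {l : ℝ} (hl : 0 < l) {u u' : ℝ → ℝ} (hu : IsH1 l u u') :
    ∀ᵐ x ∂(volume.restrict (Ioo 0 l)), HasDerivAt u (u' x) x := by
  have h1 := (hu.intervalIntegrable (right_mem_Icc.mpr hl.le)).ae_hasDerivAt_integral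
  filter_upwards [ae_restrict_of_ae h1, ae_restrict_mem measurableSet_Ioo] with x hx hm
  have hx' := (hx (by rw [uIcc_of_le hl.le]; exact Ioo_subset_Icc_self hm) 0
    left_mem_uIcc).const_add (u 0)
  refine hx'.congr_of_eventuallyEq ?_
  filter_upwards [isOpen_Ioo.mem_nhds hm] with y hy
  exact hu.2 y (Ioo_subset_Icc_self hy)

/-- The derivative of an `H¹` function is determined by the function, almost everywhere. -/
theorem IsH1.derivative_unique {l : ℝ} (hl : 0 < l) {u u' v v' : ℝ → ℝ} (hu : IsH1 l u u')
    (hv : IsH1 l v v') (h : u =ᵐ[volume.restrict (Ioo 0 l)] v) :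
    u' =ᵐ[volume.restrict (Ioo 0 l)] v' := by
  have hEq : EqOn u v (Ioo 0 l) :=
    Measure.eqOn_open_of_ae_eq h isOpen_Ioo (hu.continuousOn.mono Ioo_subset_Icc_self)
      (hv.continuousOn.mono Ioo_subset_Icc_self)
  filter_upwards [hu.ae_hasDerivAt hl, hv.ae_hasDerivAt hl, ae_restrict_mem measurableSet_Ioo]
    with x h1 h2 hm
  refine h1.unique (h2.congr_of_eventuallyEq ?_)
  filter_upwards [isOpen_Ioo.mem_nhds hm] with y hy
  exact hEq hy

namespace MetricGraph

variable {V : Type*} {G : SimpleGraph V}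

/-- The coordinate on the edge `e` of its end point `v`. -/
noncomputable def coord (Γ : MetricGraph G) (e : G.edgeSet) (v : V) : ℝ :=
  open Classical in if v = Γ.src e then 0 else Γ.length e

/-- The derivative at the end point `v` of the edge `e`, taken in the direction away from `v`
(into the edge), of a function on `[0, ℓ_e]` with derivative `u'`. -/
noncomputable def outwardDeriv (Γ : MetricGraph G) (e : G.edgeSet) (v : V) (u' : ℝ → ℝ) : ℝ :=
  open Classical in if v = Γ.src e then u' 0 else -u' (Γ.length e)

/-- Continuity at the vertices: at every vertex the values along all incident edges coincide. -/
def VertexContinuous (Γ : MetricGraph G) (u : G.edgeSet → ℝ → ℝ) : Prop :=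
  ∀ (v : V) (e₁ e₂ : G.edgeSet), v ∈ (e₁ : Sym2 V) → v ∈ (e₂ : Sym2 V) →
    u e₁ (Γ.coord e₁ v) = u e₂ (Γ.coord e₂ v)

variable [Fintype G.edgeSet]

/-- The Kirchhoff condition: at every vertex `v`, the sum of `c_e(v) u_e'(v)` over the edges `e`
incident to `v` vanishes. -/
def Kirchhoff (Γ : MetricGraph G) (c u' : G.edgeSet → ℝ → ℝ) : Prop :=
  open Classical in
  ∀ v : V, ∑ e ∈ Finset.univ.filter (fun e : G.edgeSet => v ∈ (e : Sym2 V)),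
    c e (Γ.coord e v) * Γ.outwardDeriv e v (u' e) = 0

/-- The state space: the Hilbert space product of the spaces `L²(0, ℓ_e)`. -/
abbrev StateSpace (Γ : MetricGraph G) : Type _ :=
  PiLp 2 fun e : G.edgeSet => Lp ℝ 2 (volume.restrict (Ioo (0 : ℝ) (Γ.length e)))

/-- The relation "`f` belongs to the domain of `A` and `A f = h`", where `A` acts as
`(c_e u')' - p_e u` on each edge. The function `u` is the continuous representative of `f`, `u'` its
derivative, `w = c u'` the flux, which is again `H¹` on each edge, and `w'` the derivative of the
flux. -/
def OperatorRel (Γ : MetricGraph G) (c p : G.edgeSet → ℝ → ℝ) (f h : Γ.StateSpace) : Prop :=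
  ∃ u u' w w' : G.edgeSet → ℝ → ℝ,
    (∀ e, f e =ᵐ[volume.restrict (Ioo 0 (Γ.length e))] u e) ∧
    (∀ e, IsH1 (Γ.length e) (u e) (u' e)) ∧
    (∀ e, IsH1 (Γ.length e) (w e) (w' e)) ∧
    (∀ e, ∀ x ∈ Icc 0 (Γ.length e), w e x = c e x * u' e x) ∧
    Γ.VertexContinuous u ∧
    Γ.Kirchhoff c u' ∧
    (∀ e, h e =ᵐ[volume.restrict (Ioo 0 (Γ.length e))] fun x => w' e x - p e x * u e x)

/-- The graph of the operator `A`. -/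
def operatorGraph (Γ : MetricGraph G) (c p : G.edgeSet → ℝ → ℝ) :
    Submodule ℝ (Γ.StateSpace × Γ.StateSpace) where
  carrier := {q | Γ.OperatorRel c p q.1 q.2}
  zero_mem' := by
    refine ⟨0, 0, 0, 0, fun e => ?_, fun e => IsH1.zero _, fun e => IsH1.zero _, ?_, ?_, ?_,
      fun e => ?_⟩
    · exact Lp.coeFn_zero _ _ _
    · simp
    · intro v e₁ e₂ _ _
      simp
    · intro v
      simp [outwardDeriv]
    · filter_upwards [Lp.coeFn_zero ℝ 2 (volume.restrict (Ioo (0 : ℝ) (Γ.length e)))] with x hx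
      simpa using hx
  add_mem' := by
    rintro ⟨f₁, h₁⟩ ⟨f₂, h₂⟩ ⟨u₁, u₁', w₁, w₁', a₁, b₁, c₁, d₁, i₁, j₁, k₁⟩
      ⟨u₂, u₂', w₂, w₂', a₂, b₂, c₂, d₂, i₂, j₂, k₂⟩
    refine ⟨u₁ + u₂, u₁' + u₂', w₁ + w₂, w₁' + w₂', fun e => ?_, fun e => (b₁ e).add (b₂ e),
      fun e => (c₁ e).add (c₂ e), fun e x hx => ?_, fun v e₁ e₂ m₁ m₂ => ?_, fun v => ?_,
      fun e => ?_⟩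
    · filter_upwards [Lp.coeFn_add (f₁ e) (f₂ e), a₁ e, a₂ e] with x hx y z
      simp only [PiLp.add_apply, Prod.mk_add_mk, Pi.add_apply, hx, y, z]
    · simp only [Pi.add_apply, d₁ e x hx, d₂ e x hx]
      ring
    · simp only [Pi.add_apply, i₁ v e₁ e₂ m₁ m₂, i₂ v e₁ e₂ m₁ m₂]
    · have s := congrArg₂ (· + ·) (j₁ v) (j₂ v)
      simp only [← Finset.sum_add_distrib, add_zero] at s
      rw [← s]
      refine Finset.sum_congr rfl fun e _ => ?_
      unfold outwardDeriv
      split_ifs <;> simp only [Pi.add_apply] <;> ring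
    · filter_upwards [Lp.coeFn_add (h₁ e) (h₂ e), k₁ e, k₂ e] with x hx y z
      simp only [PiLp.add_apply, Prod.mk_add_mk, Pi.add_apply, hx, y, z]
      ring
  smul_mem' := by
    rintro r ⟨f, h⟩ ⟨u, u', w, w', a₁, b₁, c₁, d₁, i₁, j₁, k₁⟩
    refine ⟨r • u, r • u', r • w, r • w', fun e => ?_, fun e => (b₁ e).smul r,
      fun e => (c₁ e).smul r, fun e x hx => ?_, fun v e₁ e₂ m₁ m₂ => ?_, fun v => ?_,
      fun e => ?_⟩
    · filter_upwards [Lp.coeFn_smul r (f e), a₁ e] with x hx y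
      simp only [PiLp.smul_apply, Prod.smul_mk, Pi.smul_apply, hx, y]
    · simp only [Pi.smul_apply, smul_eq_mul, d₁ e x hx]
      ring
    · simp only [Pi.smul_apply, i₁ v e₁ e₂ m₁ m₂]
    · have s := congrArg (r * ·) (j₁ v)
      simp only [Finset.mul_sum, mul_zero] at s
      rw [← s]
      refine Finset.sum_congr rfl fun e _ => ?_
      unfold outwardDeriv
      split_ifs <;> simp only [Pi.smul_apply, smul_eq_mul] <;> ring
    · filter_upwards [Lp.coeFn_smul r (h e), k₁ e] with x hx y
      simp only [PiLp.smul_apply, Prod.smul_mk, Pi.smul_apply, hx, y, smul_eq_mul]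
      ring

theorem operatorRel_unique (Γ : MetricGraph G) (c p : G.edgeSet → ℝ → ℝ) {f h₁ h₂ : Γ.StateSpace}
    (H₁ : Γ.OperatorRel c p f h₁) (H₂ : Γ.OperatorRel c p f h₂) : h₁ = h₂ := by
  obtain ⟨u₁, u₁', w₁, w₁', a₁, b₁, c₁, d₁, -, -, k₁⟩ := H₁
  obtain ⟨u₂, u₂', w₂, w₂', a₂, b₂, c₂, d₂, -, -, k₂⟩ := H₂
  ext1 e
  refine Lp.ext ?_
  have hu := (a₁ e).symm.trans (a₂ e)
  have hu' := (b₁ e).derivative_unique (Γ.length_pos e) (b₂ e) hu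
  have hw : w₁ e =ᵐ[volume.restrict (Ioo 0 (Γ.length e))] w₂ e := by
    filter_upwards [hu', ae_restrict_mem measurableSet_Ioo] with x hx hm
    rw [d₁ e x (Ioo_subset_Icc_self hm), d₂ e x (Ioo_subset_Icc_self hm), hx]
  filter_upwards [k₁ e, k₂ e, hu, (c₁ e).derivative_unique (Γ.length_pos e) (c₂ e) hw] with x p₁ p₂ p₃ p₄
  rw [p₁, p₂, p₃, p₄]

/-- The operator `A`: it acts as `(c_e u')' - p_e u` on each edge, and its domain consists of the
functions `u` that are `H¹` with `c u'` in `H¹` on each edge, continuous at the vertices, and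
satisfy the Kirchhoff condition at each vertex. -/
noncomputable def operator (Γ : MetricGraph G) (c p : G.edgeSet → ℝ → ℝ) :
    Γ.StateSpace →ₗ.[ℝ] Γ.StateSpace :=
  (Γ.operatorGraph c p).toLinearPMap

theorem mem_operator_graph_iff (Γ : MetricGraph G) (c p : G.edgeSet → ℝ → ℝ)
    (f h : Γ.StateSpace) : (f, h) ∈ (Γ.operator c p).graph ↔ Γ.OperatorRel c p f h := by
  unfold operator
  rw [Submodule.toLinearPMap_graph_eq]
  · rfl
  · rintro ⟨x, y⟩ hx (rfl : x = 0)
    exact Γ.operatorRel_unique c p hx (Γ.operatorGraph c p).zero_mem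

/-- `eig 0 ≥ eig 1 ≥ …` is the sequence of eigenvalues of `A`, repeated according to multiplicity:
there is a complete orthonormal system of eigenfunctions `f k` with `A (f k) = eig k • f k`. -/
def IsEigenvalueSequence (Γ : MetricGraph G) (c p : G.edgeSet → ℝ → ℝ) (eig : ℕ → ℝ) : Prop :=
  Antitone eig ∧
    ∃ f : HilbertBasis ℕ ℝ Γ.StateSpace, ∀ k : ℕ,
      ∃ hk : f k ∈ (Γ.operator c p).domain, Γ.operator c p ⟨f k, hk⟩ = eig k • f k

end MetricGraph

/-!
The operator `-A` comes from the symmetric form `a(u, v) = ∑ₑ ∫ c u' v' + p u v` on the functions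
that are `H¹` on every edge and continuous at the vertices; the Kirchhoff condition is the natural
boundary condition of `a`. Since `a` is bounded below by `c₀ ‖u'‖²` and its domain embeds compactly
into the state space, `(1 - A)⁻¹` is compact, positive and injective, whence the eigenbasis.

By the min-max principle the growth of the eigenvalues is read off from test spaces. Vanishing at
`n` equidistant points of every edge defines a subspace of codimension at most `|E| n`, on which
the Poincaré inequality gives `n² ‖u‖² ≤ C ‖u'‖²`. Conversely, the first `n` Dirichlet sines of a
single edge span an `n`-dimensional space on which `‖u'‖² ≤ C n² ‖u‖²`.
-/

/-! ### Compact operators on Hilbert spaces -/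

theorem exists_seq_forall_image_range {α : Type*} [DecidableEq α] {P : Finset α → α → Prop}
    (h : ∀ s, ∃ y, P s y) : ∃ f : ℕ → α, ∀ n, P ((Finset.range n).image f) (f n) := by
  choose next hnext using h
  let s : ℕ → Finset α := fun n => (fun t => insert (next t) t)^[n] ∅
  have s_eq : ∀ n, s n = (Finset.range n).image fun i => next (s i) := by
    intro n
    induction n with
    | zero => rfl
    | succ n ih =>
      rw [Finset.range_add_one, Finset.image_insert, ← ih]
      exact Function.iterate_succ_apply' _ _ _
  exact ⟨fun n => next (s n), fun n => s_eq n ▸ hnext (s n)⟩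

section CompactPositive

variable {H : Type*} [NormedAddCommGroup H] [InnerProductSpace ℝ H]
  {T : H →L[ℝ] H}

/-- An orthonormal sequence of eigenvectors obtained by maximising `‖T w‖` over the unit vectors `w`
orthogonal to the earlier members; the eigenvalue of `v n` is `‖T (v n)‖`. -/
structure IsGreedyEigensequence (T : H →L[ℝ] H) (v : ℕ → H) : Prop where
  orthonormal : Orthonormal ℝ v
  apply_eq : ∀ n, T (v n) = ‖T (v n)‖ • v n
  norm_apply_le : ∀ n, ∀ w ∈ (Submodule.span ℝ (v '' Iio n))ᗮ, ‖T w‖ ≤ ‖T (v n)‖ * ‖w‖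

namespace IsGreedyEigensequence

variable {v : ℕ → H}

theorem antitone_norm_apply (hv : IsGreedyEigensequence T v) : Antitone fun n => ‖T (v n)‖ := by
  intro i j hij
  have : v j ∈ (Submodule.span ℝ (v '' Iio i))ᗮ := by
    have : Submodule.span ℝ (v '' Iio i) ⟂ Submodule.span ℝ {v j} := by
      rw [Submodule.isOrtho_span]
      rintro _ ⟨n, hn, rfl⟩ _ rfl
      exact hv.orthonormal.2 (lt_of_lt_of_le hn hij).ne
    exact this.symm (Submodule.mem_span_singleton_self _)
  simpa [hv.orthonormal.1 j] using hv.norm_apply_le i (v j) this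

theorem exists_norm_apply_lt (hv : IsGreedyEigensequence T v) (hT : IsCompactOperator T) {ε : ℝ}
    (hε : 0 < ε) : ∃ n, ‖T (v n)‖ < ε := by
  by_contra! hle
  obtain ⟨K, hK, hKs⟩ :=
    IsCompactOperator.image_closedBall_subset_compact (f := (T : H →ₗ[ℝ] H)) hT 1
  obtain ⟨a, -, φ, hφ, hlim⟩ := hK.tendsto_subseq fun n =>
    hKs ⟨v n, by simp [hv.orthonormal.1], rfl⟩
  obtain ⟨N, hN⟩ := Metric.cauchySeq_iff'.mp hlim.cauchySeq ε hε
  have close : ‖T (v (φ (N + 1))) - T (v (φ N))‖ < ε := by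
    simpa [dist_eq_norm] using hN (N + 1) N.le_succ
  have orthogonal : inner ℝ (T (v (φ (N + 1)))) (T (v (φ N))) = 0 := by
    rw [hv.apply_eq, hv.apply_eq (φ N), inner_smul_left, inner_smul_right,
      hv.orthonormal.2 (hφ N.lt_succ_self).ne']
    simp
  have pythagoras := norm_sub_sq_real (T (v (φ (N + 1)))) (T (v (φ N)))
  nlinarith [hle (φ N), norm_nonneg (T (v (φ (N + 1))) - T (v (φ N)))]

theorem span_orthogonal_eq_bot (hv : IsGreedyEigensequence T v) (hT : IsCompactOperator T)
    (hinj : Function.Injective T) : (Submodule.span ℝ (range v))ᗮ = ⊥ := by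
  rw [Submodule.eq_bot_iff]
  intro g hg
  have norm_apply_le : ∀ n, ‖T g‖ ≤ ‖T (v n)‖ * ‖g‖ := fun n => hv.norm_apply_le n g
    (Submodule.orthogonal_le (Submodule.span_mono (image_subset_range _ _)) hg)
  by_contra hg0
  have hTg : 0 < ‖T g‖ := norm_pos_iff.mpr fun h => hg0 (hinj (h.trans (map_zero T).symm))
  obtain ⟨n, hn⟩ := hv.exists_norm_apply_lt hT (div_pos hTg (norm_pos_iff.mpr hg0))
  exact (norm_apply_le n).not_gt ((lt_div_iff₀ (norm_pos_iff.mpr hg0)).mp hn)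

end IsGreedyEigensequence

variable [CompleteSpace H]

theorem exists_unit_eigenvector_of_compact_of_isPositive (hT : IsCompactOperator T)
    (hpos : T.IsPositive) (h0 : T ≠ 0) : ∃ v : H, ‖v‖ = 1 ∧ T v = ‖T‖ • v := by
  have hn : 0 < ‖T‖ := norm_pos_iff.mpr h0
  have : Nontrivial H := by
    obtain ⟨x, hx⟩ := DFunLike.ne_iff.mp h0
    exact ⟨⟨T x, 0, hx⟩⟩
  have norm_mem_spectrum : ‖T‖ ∈ spectrum ℝ T := by
    intro hres
    obtain ⟨ε, hε, hle⟩ := T.rayleighQuotient_le_of_norm_mem_resolventSet (𝕜 := ℝ) hres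
    have : ‖T‖ ≤ ‖T‖ - ε := by
      conv_lhs => rw [T.norm_eq_iSup_rayleighQuotient hpos.isSymmetric]
      refine ciSup_le fun x => ?_
      exact (abs_of_nonneg (div_nonneg (hpos.inner_nonneg_left x) (sq_nonneg _))).trans_le (hle x)
    linarith
  obtain ⟨v, hv⟩ := ((hT.hasEigenvalue_iff_mem_spectrum hn.ne').mpr
    norm_mem_spectrum).exists_hasEigenvector
  have hv0 : ‖v‖ ≠ 0 := norm_ne_zero_iff.mpr hv.2
  refine ⟨‖v‖⁻¹ • v, by simp [norm_smul, hv0], ?_⟩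
  rw [map_smul, show T v = ‖T‖ • v from hv.apply_eq_smul, smul_comm]

theorem exists_eigenvector_orthogonal_of_invariant (hT : IsCompactOperator T)
    (hpos : T.IsPositive) (hinj : Function.Injective T) {F : Submodule ℝ H}
    (hFT : ∀ x ∈ F, T x ∈ F) (hF : Fᗮ ≠ ⊥) :
    ∃ v ∈ Fᗮ, ‖v‖ = 1 ∧ T v = ‖T v‖ • v ∧ ∀ w ∈ Fᗮ, ‖T w‖ ≤ ‖T v‖ * ‖w‖ := by
  have invariant : ∀ x ∈ Fᗮ, T x ∈ Fᗮ := fun x hx y hy =>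
    (hpos.inner_left_eq_inner_right y x).symm.trans (hx _ (hFT y hy))
  let S : Fᗮ →L[ℝ] Fᗮ := T.restrict invariant
  have hS0 : S ≠ 0 := by
    obtain ⟨z, hz, hz0⟩ := Submodule.exists_mem_ne_zero_of_ne_bot hF
    intro h
    have hSz : S ⟨z, hz⟩ = 0 := by rw [h, zero_apply]
    exact hz0 (hinj ((congrArg Subtype.val hSz).trans (map_zero T).symm))
  have hS : S.IsPositive := ⟨hpos.isSymmetric.restrict_invariant invariant, fun x => hpos.2 x⟩
  obtain ⟨v, hv, hSv⟩ :=
    exists_unit_eigenvector_of_compact_of_isPositive (hT.restrict' invariant) hS hS0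
  have hTv : T v = ‖S‖ • (v : H) := congrArg Subtype.val hSv
  have norm_Tv : ‖T v‖ = ‖S‖ := by
    rw [hTv, norm_smul, Submodule.norm_coe, hv, mul_one]
    exact Real.norm_of_nonneg (norm_nonneg S)
  refine ⟨v, v.2, hv, norm_Tv ▸ hTv, fun w hw => ?_⟩
  rw [norm_Tv]
  exact S.le_opNorm ⟨w, hw⟩

theorem exists_eigenvector_orthogonal_finset (hinf : ¬ FiniteDimensional ℝ H)
    (hT : IsCompactOperator T) (hpos : T.IsPositive) (hinj : Function.Injective T) {s : Finset H}
    (hs : ∀ x ∈ s, T x = ‖T x‖ • x) :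
    ∃ y ∈ (Submodule.span ℝ (s : Set H))ᗮ, ‖y‖ = 1 ∧ T y = ‖T y‖ • y ∧
      ∀ w ∈ (Submodule.span ℝ (s : Set H))ᗮ, ‖T w‖ ≤ ‖T y‖ * ‖w‖ := by
  refine exists_eigenvector_orthogonal_of_invariant hT hpos hinj (fun x hx => ?_) fun h => ?_
  · induction hx using Submodule.span_induction with
    | mem x hx =>
      rw [hs x hx]
      exact Submodule.smul_mem _ _ (Submodule.subset_span hx)
    | zero => simp
    | add x y _ _ hx hy => simpa using add_mem hx hy
    | smul a x _ hx => simpa using Submodule.smul_mem _ a hx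
  · rw [Submodule.orthogonal_eq_bot_iff] at h
    exact hinf (Module.finite_def.mpr (h ▸ Submodule.fg_span s.finite_toSet))

theorem exists_isGreedyEigensequence (hinf : ¬ FiniteDimensional ℝ H) (hT : IsCompactOperator T)
    (hpos : T.IsPositive) (hinj : Function.Injective T) :
    ∃ v : ℕ → H, IsGreedyEigensequence T v := by
  classical
  let Next : Finset H → H → Prop := fun s y => (∀ x ∈ s, T x = ‖T x‖ • x) →
    y ∈ (Submodule.span ℝ (s : Set H))ᗮ ∧ ‖y‖ = 1 ∧ T y = ‖T y‖ • y ∧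
      ∀ w ∈ (Submodule.span ℝ (s : Set H))ᗮ, ‖T w‖ ≤ ‖T y‖ * ‖w‖
  have exists_next : ∀ s, ∃ y, Next s y := by
    intro s
    by_cases hs : ∀ x ∈ s, T x = ‖T x‖ • x
    · obtain ⟨y, hy⟩ := exists_eigenvector_orthogonal_finset hinf hT hpos hinj hs
      exact ⟨y, fun _ => hy⟩
    · exact ⟨0, fun h => absurd h hs⟩
  obtain ⟨v, hv⟩ := exists_seq_forall_image_range exists_next
  have eigen : ∀ n, T (v n) = ‖T (v n)‖ • v n := by
    intro n
    induction n using Nat.strong_induction_on with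
    | _ n ih =>
      refine (hv n ?_).2.2.1
      simpa [Finset.forall_mem_image] using ih
  have coe_image : ∀ n, (((Finset.range n).image v : Finset H) : Set H) = v '' Iio n := by
    simp
  have greedy := fun n => hv n (by simpa [Finset.forall_mem_image] using fun i _ => eigen i)
  simp only [coe_image] at greedy
  have orthogonal : ∀ i j, i < j → inner ℝ (v i) (v j) = 0 := fun i j hij =>
    (greedy j).1 _ (Submodule.subset_span ⟨i, hij, rfl⟩)
  refine ⟨v, ⟨fun n => (greedy n).2.1, fun i j hij => ?_⟩, eigen, fun n => (greedy n).2.2.2⟩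
  rcases lt_or_gt_of_ne hij with h | h
  · exact orthogonal i j h
  · exact (real_inner_comm _ _).trans (orthogonal j i h)

theorem exists_hilbertBasis_eigenvectors_of_compact_of_isPositive
    (hinf : ¬ FiniteDimensional ℝ H) (hT : IsCompactOperator T) (hpos : T.IsPositive)
    (hinj : Function.Injective T) :
    ∃ (f : HilbertBasis ℕ ℝ H) (m : ℕ → ℝ), Antitone m ∧ (∀ k, 0 < m k) ∧
      ∀ k, T (f k) = m k • f k := by
  obtain ⟨v, hv⟩ := exists_isGreedyEigensequence hinf hT hpos hinj
  refine ⟨HilbertBasis.mkOfOrthogonalEqBot hv.orthonormal (hv.span_orthogonal_eq_bot hT hinj),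
    fun k => ‖T (v k)‖, hv.antitone_norm_apply, fun k => ?_, fun k => ?_⟩
  · refine norm_pos_iff.mpr fun h => hv.orthonormal.ne_zero k ?_
    exact hinj (h.trans (map_zero T).symm)
  · rw [HilbertBasis.coe_mkOfOrthogonalEqBot]
    exact hv.apply_eq k

end CompactPositive

theorem isCompactOperator_of_small_on_finite_codim {H H' : Type*} [NormedAddCommGroup H]
    [InnerProductSpace ℝ H] [CompleteSpace H] [NormedAddCommGroup H'] [NormedSpace ℝ H']
    [CompleteSpace H'] (J : H →L[ℝ] H')
    (h : ∀ ε > 0, ∃ (N : ℕ) (Φ : H →L[ℝ] (Fin N → ℝ)), ∀ x, Φ x = 0 → ‖J x‖ ≤ ε * ‖x‖) :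
    IsCompactOperator J := by
  refine (isClosed_setOfPred_isCompactOperator (σ₁₂ := RingHom.id ℝ)).closure_subset
    (Metric.mem_closure_iff.mpr fun ε hε => ?_)
  obtain ⟨N, Φ, hΦ⟩ := h (ε / 2) (half_pos hε)
  let K : Submodule ℝ H := LinearMap.ker (Φ : H →ₗ[ℝ] (Fin N → ℝ))
  have : CompleteSpace K := Φ.isClosed_ker.completeSpace_coe
  have : FiniteDimensional ℝ Kᗮ := by
    refine FiniteDimensional.of_injective ((Φ : H →ₗ[ℝ] (Fin N → ℝ)) ∘ₗ Kᗮ.subtype) ?_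
    rw [← LinearMap.ker_eq_bot, LinearMap.ker_eq_bot']
    exact fun x hx => Subtype.ext (inner_self_eq_zero.mp (x.2 _ (show (x : H) ∈ K from hx)))
  refine ⟨J ∘L Kᗮ.starProjection, ?_, ?_⟩
  · refine IsCompactOperator.comp_clm (f := J ∘L Kᗮ.subtypeL) ?_ Kᗮ.orthogonalProjectionOnto
    exact ((isCompactOperator_id_iff_finiteDimensional (𝕜 := ℝ)).mpr inferInstance).clm_comp _
  · rw [dist_eq_norm]
    refine (ContinuousLinearMap.opNorm_le_bound _ (half_pos hε).le fun x => ?_).trans_lt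
      (half_lt_self hε)
    have : (J - J ∘L Kᗮ.starProjection) x = J (K.starProjection x) := by
      conv_lhs => rw [← K.starProjection_add_starProjection_orthogonal x]
      simp
    rw [this]
    refine (hΦ _ (K.starProjection_apply_mem x)).trans ?_
    gcongr
    exact K.norm_starProjection_apply_le x

/-! ### Forms with a compact embedding and their eigenvalues -/

section WeakForm

variable {E H : Type*} [NormedAddCommGroup E] [InnerProductSpace ℝ E]
  [NormedAddCommGroup H] [InnerProductSpace ℝ H] {a : E →L[ℝ] E →L[ℝ] ℝ} {J : E →L[ℝ] H}

/-- The relation "`f` belongs to the domain of the operator associated with the form `-a`, and the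
operator maps `f` to `h`", for a form `a` whose domain `E` is mapped to `H` by `J`. -/
def WeakRel (a : E →L[ℝ] E →L[ℝ] ℝ) (J : E →L[ℝ] H) (f h : H) : Prop :=
  ∃ x, J x = f ∧ ∀ y, a x y = -inner ℝ h (J y)

theorem WeakRel.smul {f h : H} (hfh : WeakRel a J f h) (r : ℝ) : WeakRel a J (r • f) (r • h) := by
  obtain ⟨x, hx, hax⟩ := hfh
  refine ⟨r • x, by rw [map_smul, hx], fun y => ?_⟩
  rw [map_smul, smul_apply, hax, real_inner_smul_left, smul_eq_mul, mul_neg]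

theorem WeakRel.eigenvalue_nonpos (hpos : ∀ x, 0 ≤ a x x) {f : H} (hf : f ≠ 0) {r : ℝ}
    (h : WeakRel a J f (r • f)) : r ≤ 0 := by
  obtain ⟨x, hx, hax⟩ := h
  have := hpos x
  rw [hax, hx, real_inner_smul_left, real_inner_self_eq_norm_sq, Left.nonneg_neg_iff] at this
  exact nonpos_of_mul_nonpos_left this (by positivity)

theorem exists_weak_resolvent [CompleteSpace E] [CompleteSpace H] (hsymm : ∀ x y, a x y = a y x)
    (hcoer : ∃ δ > 0, ∀ x, δ * ‖x‖ * ‖x‖ ≤ a x x + inner ℝ (J x) (J x)) (hJ : DenseRange J) :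
    ∃ S : H →L[ℝ] E, (J ∘L S).IsPositive ∧ Function.Injective (J ∘L S) ∧
      ∀ f, WeakRel a J (J (S f)) (J (S f) - f) := by
  let G : H →L[ℝ] H →L[ℝ] ℝ := innerSL ℝ
  let B : E →L[ℝ] E →L[ℝ] ℝ := a + G.bilinearComp J J
  have B_apply : ∀ x y, B x y = a x y + inner ℝ (J x) (J y) := fun x y => rfl
  obtain ⟨δ, hδ, le_B⟩ : IsCoercive B := hcoer
  have hB : IsCoercive B := ⟨δ, hδ, le_B⟩
  let S : H →L[ℝ] E := (hB.continuousLinearEquivOfBilin.symm : E →L[ℝ] E) ∘L J.adjoint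
  have B_S : ∀ f y, B (S f) y = inner ℝ f (J y) := by
    intro f y
    rw [← hB.continuousLinearEquivOfBilin_apply]
    simp only [S, ContinuousLinearMap.comp_apply, ContinuousLinearEquiv.coe_coe,
      ContinuousLinearEquiv.apply_symm_apply]
    exact J.adjoint_inner_left y f
  have inner_R : ∀ f g, inner ℝ f (J (S g)) = B (S f) (S g) := fun f g => (B_S f (S g)).symm
  have B_symm : ∀ x y, B x y = B y x := fun x y => by
    rw [B_apply, B_apply, hsymm, real_inner_comm]
  refine ⟨S, (ContinuousLinearMap.isPositive_iff _).mpr ⟨fun f g => ?_, fun f => ?_⟩,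
    (injective_iff_map_eq_zero _).mpr fun f hf => ?_, fun f => ⟨S f, rfl, fun y => ?_⟩⟩
  · change inner ℝ (J (S f)) g = inner ℝ f (J (S g))
    rw [real_inner_comm, inner_R, inner_R, B_symm]
  · rw [ContinuousLinearMap.comp_apply, real_inner_comm, inner_R]
    exact le_trans (by positivity) (le_B (S f))
  · have hSf : S f = 0 := by
      have := le_B (S f)
      rw [B_S, show J (S f) = 0 from hf, inner_zero_right] at this
      by_contra hne
      exact this.not_gt (by positivity)
    refine hJ.eq_zero_of_inner_left ℝ fun y => ?_
    rw [← B_S, hSf, map_zero, zero_apply]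
  · rw [inner_sub_left, ← B_S f y, B_apply]
    ring

theorem exists_weak_eigenbasis [CompleteSpace E] [CompleteSpace H] (hinf : ¬ FiniteDimensional ℝ H)
    (hsymm : ∀ x y, a x y = a y x)
    (hcoer : ∃ δ > 0, ∀ x, δ * ‖x‖ * ‖x‖ ≤ a x x + inner ℝ (J x) (J x))
    (hcompact : IsCompactOperator J) (hdense : DenseRange J) :
    ∃ (f : HilbertBasis ℕ ℝ H) (eig : ℕ → ℝ), Antitone eig ∧
      ∀ k, WeakRel a J (f k) (eig k • f k) := by
  obtain ⟨S, hpos, hinj, hS⟩ := exists_weak_resolvent hsymm hcoer hdense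
  obtain ⟨f, m, hm, hmpos, hfm⟩ := exists_hilbertBasis_eigenvectors_of_compact_of_isPositive hinf
    (hcompact.comp_clm S) hpos hinj
  refine ⟨f, fun k => 1 - (m k)⁻¹, fun i j hij => ?_, fun k => ?_⟩
  · exact sub_le_sub_left (inv_anti₀ (hmpos j) (hm hij)) 1
  · have hf_eig := (hS (f k)).smul (m k)⁻¹
    rw [show J (S (f k)) = m k • f k from hfm k, smul_sub, inv_smul_smul₀ (hmpos k).ne'] at hf_eig
    simpa only [sub_smul, one_smul] using hf_eig

theorem form_sum_apply {ι : Type*} (s : Finset ι) {f : ι → H} {x : ι → E} {eig : ι → ℝ}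
    (hax : ∀ i y, a (x i) y = -inner ℝ (eig i • f i) (J y)) (c : ι → ℝ) (y : E) :
    a (∑ i ∈ s, c i • x i) y = ∑ i ∈ s, c i * (-eig i) * inner ℝ (f i) (J y) := by
  rw [map_sum, _root_.sum_apply]
  refine Finset.sum_congr rfl fun i _ => ?_
  rw [map_smul, smul_apply, hax, real_inner_smul_left, smul_eq_mul]
  ring

theorem form_sum_self {ι : Type*} (s : Finset ι) {f : ι → H} (hf : Orthonormal ℝ f) {x : ι → E}
    {eig : ι → ℝ} (hx : ∀ i, J (x i) = f i)
    (hax : ∀ i y, a (x i) y = -inner ℝ (eig i • f i) (J y)) (c : ι → ℝ) :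
    a (∑ i ∈ s, c i • x i) (∑ i ∈ s, c i • x i) = ∑ i ∈ s, -eig i * c i ^ 2 := by
  rw [form_sum_apply s hax]
  refine Finset.sum_congr rfl fun i hi => ?_
  simp only [map_sum, map_smul, hx]
  rw [hf.inner_right_sum c hi]
  ring

/-! ### Min-max bounds -/

theorem le_neg_eigenvalue_of_codim_le {W : Type*} [AddCommGroup W] [Module ℝ W]
    [FiniteDimensional ℝ W] {f : ℕ → H} (hf : Orthonormal ℝ f) {eig : ℕ → ℝ} (heig : Antitone eig)
    (hw : ∀ k, WeakRel a J (f k) (eig k • f k)) {k : ℕ} (Φ : E →ₗ[ℝ] W)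
    (hW : Module.finrank ℝ W ≤ k) {M : ℝ} (hM : ∀ x, Φ x = 0 → M * ‖J x‖ ^ 2 ≤ a x x) :
    M ≤ -eig k := by
  choose x hx hax using hw
  let b : (Fin (k + 1) → ℝ) →ₗ[ℝ] E := Fintype.linearCombination ℝ fun i : Fin (k + 1) => x i
  obtain ⟨c, hc, hc0⟩ := Submodule.exists_mem_ne_zero_of_ne_bot
    (LinearMap.ker_ne_bot_of_finrank_lt (f := Φ ∘ₗ b) (by simpa using Nat.lt_succ_of_le hW))
  have hb : b c = ∑ i : Fin (k + 1), c i • x i := Fintype.linearCombination_apply ℝ _ _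
  have hfk : Orthonormal ℝ fun i : Fin (k + 1) => f i := hf.comp _ Fin.val_injective
  have hnorm : ‖J (b c)‖ ^ 2 = ∑ i, c i ^ 2 := by
    rw [hb, map_sum, ← real_inner_self_eq_norm_sq]
    simp only [map_smul, hx]
    rw [hfk.inner_sum]
    simp only [conj_trivial, sq]
  have hpos : 0 < ‖J (b c)‖ ^ 2 := by
    obtain ⟨i, hi⟩ := Function.ne_iff.mp hc0
    rw [hnorm]
    exact Finset.sum_pos' (fun _ _ => sq_nonneg _) ⟨i, Finset.mem_univ _, sq_pos_of_ne_zero hi⟩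
  have hform : a (b c) (b c) ≤ -eig k * ‖J (b c)‖ ^ 2 := by
    rw [hnorm, hb, form_sum_self Finset.univ hfk (fun i => hx i) (fun i => hax i), Finset.mul_sum]
    refine Finset.sum_le_sum fun i _ => ?_
    gcongr
    exact heig (Nat.lt_succ_iff.mp i.2)
  exact le_of_mul_le_mul_right ((hM _ hc).trans hform) hpos

theorem sum_neg_eigenvalue_mul_sq_le_form (hpos : ∀ x, 0 ≤ a x x) (hsymm : ∀ x y, a x y = a y x)
    {ι : Type*} {f : ι → H} (hf : Orthonormal ℝ f) {eig : ι → ℝ}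
    (hw : ∀ i, WeakRel a J (f i) (eig i • f i)) (s : Finset ι) (z : E) :
    ∑ i ∈ s, -eig i * inner ℝ (f i) (J z) ^ 2 ≤ a z z := by
  choose x hx hax using hw
  let c : ι → ℝ := fun i => inner ℝ (f i) (J z)
  let P := ∑ i ∈ s, c i • x i
  have form_P_self : a P P = ∑ i ∈ s, -eig i * c i ^ 2 := form_sum_self s hf hx hax c
  have form_P : a P z = ∑ i ∈ s, -eig i * c i ^ 2 :=
    (form_sum_apply s hax c z).trans (Finset.sum_congr rfl fun i _ => by ring)
  have form_sub : a (z - P) (z - P) = a z z - ∑ i ∈ s, -eig i * c i ^ 2 := by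
    simp only [map_sub, sub_apply]
    rw [hsymm z P, form_P, form_P_self]
    ring
  exact sub_nonneg.mp (form_sub ▸ hpos (z - P))

theorem neg_eigenvalue_mul_norm_sq_le_form (hpos : ∀ x, 0 ≤ a x x)
    (hsymm : ∀ x y, a x y = a y x) (f : HilbertBasis ℕ ℝ H) {eig : ℕ → ℝ} (heig : Antitone eig)
    (hw : ∀ k, WeakRel a J (f k) (eig k • f k)) {k : ℕ} {z : E}
    (hz : ∀ j < k, inner ℝ (f j) (J z) = (0 : ℝ)) : -eig k * ‖J z‖ ^ 2 ≤ a z z := by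
  have parseval := (f.hasSum_inner_mul_inner (J z) (J z)).tendsto_sum_nat.const_mul (-eig k)
  rw [real_inner_self_eq_norm_sq] at parseval
  refine le_of_tendsto' parseval fun N => le_trans ?_
    (sum_neg_eigenvalue_mul_sq_le_form hpos hsymm f.orthonormal hw (Finset.range N) z)
  rw [Finset.mul_sum]
  refine Finset.sum_le_sum fun j _ => ?_
  rw [real_inner_comm (f j) (J z), ← sq]
  rcases lt_or_ge j k with hj | hj
  · simp [hz j hj]
  · gcongr
    exact heig hj

theorem neg_eigenvalue_le_of_lt_finrank {W : Type*} [AddCommGroup W] [Module ℝ W]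
    [FiniteDimensional ℝ W] (hpos : ∀ x, 0 ≤ a x x) (hsymm : ∀ x y, a x y = a y x)
    (f : HilbertBasis ℕ ℝ H) {eig : ℕ → ℝ} (heig : Antitone eig)
    (hw : ∀ k, WeakRel a J (f k) (eig k • f k)) {k : ℕ} (b : W →ₗ[ℝ] E)
    (hW : k < Module.finrank ℝ W) (hb : ∀ s, J (b s) = 0 → s = 0) {M : ℝ}
    (hM : ∀ s, a (b s) (b s) ≤ M * ‖J (b s)‖ ^ 2) : -eig k ≤ M := by
  let Ψ : W →ₗ[ℝ] (Fin k → ℝ) :=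
    LinearMap.pi fun i => (innerSL ℝ (f i) : H →ₗ[ℝ] ℝ) ∘ₗ (J : E →ₗ[ℝ] H) ∘ₗ b
  obtain ⟨s, hs, hs0⟩ := Submodule.exists_mem_ne_zero_of_ne_bot
    (LinearMap.ker_ne_bot_of_finrank_lt (f := Ψ) (by simpa using hW))
  have hperp : ∀ j < k, inner ℝ (f j) (J (b s)) = (0 : ℝ) := fun j hj =>
    congrFun (LinearMap.mem_ker.mp hs) ⟨j, hj⟩
  have hne : J (b s) ≠ 0 := fun h => hs0 (hb s h)
  exact le_of_mul_le_mul_right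
    ((neg_eigenvalue_mul_norm_sq_le_form hpos hsymm f heig hw hperp).trans (hM s)) (by positivity)

theorem not_finiteDimensional_of_test (J : E →L[ℝ] H)
    (htest : ∀ n : ℕ, ∃ b : (Fin n → ℝ) →ₗ[ℝ] E, ∀ s, J (b s) = 0 → s = 0) :
    ¬ FiniteDimensional ℝ H := by
  intro hfin
  obtain ⟨b, hb⟩ := htest (Module.finrank ℝ H + 1)
  have hinj : Function.Injective ((J : E →ₗ[ℝ] H) ∘ₗ b) :=
    (injective_iff_map_eq_zero _).mpr hb
  simpa using LinearMap.finrank_le_finrank_of_injective hinj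

end WeakForm

theorem exists_mul_sq_le_add_of_sq_le {μ : ℕ → ℝ} (hμ : ∀ k, 0 ≤ μ k) {m : ℕ} (hm : 0 < m) {C : ℝ}
    (hC : 0 < C) (hle : ∀ n k : ℕ, 0 < n → m * n ≤ k → (n : ℝ) ^ 2 ≤ C * μ k) {lam : ℝ}
    (hlam : 0 < lam) : ∃ l > 0, ∀ k : ℕ, l * ((k : ℝ) + 1) ^ 2 ≤ lam + μ k := by
  have : (0 : ℝ) < m := by exact_mod_cast hm
  refine ⟨min (lam / (m : ℝ) ^ 2) (1 / (4 * C * (m : ℝ) ^ 2)), by positivity, fun k => ?_⟩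
  rcases lt_or_ge k m with hkm | hmk
  · have hk : (k : ℝ) + 1 ≤ m := by exact_mod_cast hkm
    calc min (lam / (m : ℝ) ^ 2) (1 / (4 * C * (m : ℝ) ^ 2)) * ((k : ℝ) + 1) ^ 2
        ≤ lam / (m : ℝ) ^ 2 * (m : ℝ) ^ 2 := by
          gcongr
          exact min_le_left _ _
      _ = lam := by field_simp
      _ ≤ lam + μ k := le_add_of_nonneg_right (hμ k)
  · have hk : (k : ℝ) + 1 ≤ 2 * m * ((k / m : ℕ) : ℝ) := by
      have : k + 1 ≤ 2 * m * (k / m) := by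
        have := Nat.div_pos hmk hm
        have := Nat.div_add_mod k m
        have := Nat.mod_lt k hm
        nlinarith
      exact_mod_cast this
    calc min (lam / (m : ℝ) ^ 2) (1 / (4 * C * (m : ℝ) ^ 2)) * ((k : ℝ) + 1) ^ 2
        ≤ 1 / (4 * C * (m : ℝ) ^ 2) * (2 * m * ((k / m : ℕ) : ℝ)) ^ 2 := by
          gcongr
          exact min_le_right _ _
      _ = ((k / m : ℕ) : ℝ) ^ 2 / C := by field_simp; norm_num
      _ ≤ μ k := by
          rw [div_le_iff₀' hC]
          exact hle _ k (Nat.div_pos hmk hm) (Nat.mul_div_le k m)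
      _ ≤ lam + μ k := le_add_of_nonneg_left hlam.le

/-! ### Sobolev functions on an interval -/

section Interval

variable {l : ℝ} {u u' v v' : ℝ → ℝ}

/-- The real Hilbert space `L²(0, l)` of functions on an edge of length `l`. -/
abbrev IntervalL2 (l : ℝ) : Type :=
  Lp ℝ 2 (volume.restrict (Ioo (0 : ℝ) l))

theorem memLp_of_continuousOn_Icc {p : ENNReal} {a b : ℝ} {f : ℝ → ℝ}
    (hf : ContinuousOn f (Icc a b)) : MemLp f p (volume.restrict (Ioo a b)) := by
  obtain ⟨C, hC⟩ := isCompact_Icc.exists_bound_of_continuousOn hf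
  refine MemLp.of_bound
    ((hf.mono Ioo_subset_Icc_self).aestronglyMeasurable measurableSet_Ioo) C ?_
  filter_upwards [ae_restrict_mem measurableSet_Ioo] with x hx
  exact hC x (Ioo_subset_Icc_self hx)

theorem integral_Ioo_eq_intervalIntegral {a b : ℝ} (hab : a ≤ b) (f : ℝ → ℝ) :
    ∫ x in Ioo a b, f x = ∫ x in a..b, f x := by
  rw [intervalIntegral.integral_of_le hab, integral_Ioc_eq_integral_Ioo]

theorem intervalIntegral_congr_of_ae {f g : ℝ → ℝ} (h : f =ᵐ[volume.restrict (Ioo (0 : ℝ) l)] g)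
    {t : ℝ} (ht : t ∈ Icc 0 l) : ∫ s in (0 : ℝ)..t, f s = ∫ s in (0 : ℝ)..t, g s := by
  rw [← integral_Ioo_eq_intervalIntegral ht.1, ← integral_Ioo_eq_intervalIntegral ht.1]
  exact integral_congr_ae (ae_restrict_of_ae_restrict_of_subset (Ioo_subset_Ioo_right ht.2) h)

theorem sq_integral_le_measureReal_mul_integral_sq {α : Type*} [MeasurableSpace α] {μ : Measure α}
    [IsFiniteMeasure μ] {f : α → ℝ} (hf : MemLp f 2 μ) :
    (∫ x, f x ∂μ) ^ 2 ≤ μ.real univ * ∫ x, f x ^ 2 ∂μ := by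
  have hint : Integrable f μ := hf.integrable (by norm_num)
  set M := μ.real univ with hM
  set I := ∫ x, f x ∂μ with hI
  have expand : ∫ x, (M * f x - I) ^ 2 ∂μ = M * (M * ∫ x, f x ^ 2 ∂μ - I ^ 2) := by
    have hsq : ∀ x, (M * f x - I) ^ 2 = M ^ 2 * f x ^ 2 - 2 * M * I * f x + I ^ 2 :=
      fun x => by ring
    have hsub : Integrable (fun x => M ^ 2 * f x ^ 2 - 2 * M * I * f x) μ :=
      (hf.integrable_sq.const_mul _).sub (hint.const_mul _)
    simp only [hsq]
    rw [integral_add hsub (integrable_const _), integral_sub (hf.integrable_sq.const_mul _)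
      (hint.const_mul _), integral_const_mul, integral_const_mul, integral_const, ← hM, ← hI,
      smul_eq_mul]
    ring
  rcases (measureReal_nonneg : 0 ≤ M).eq_or_lt with hM0 | hM0
  · have hμ : μ = 0 := by
      rwa [eq_comm, measureReal_eq_zero_iff, Measure.measure_univ_eq_zero] at hM0
    simp [hI, hμ]
  · have h0 : 0 ≤ M * (M * ∫ x, f x ^ 2 ∂μ - I ^ 2) :=
      expand ▸ integral_nonneg fun x => sq_nonneg _
    exact sub_nonneg.mp (nonneg_of_mul_nonneg_right h0 hM0)

theorem IsH1.of_primitive {g : ℝ → ℝ} (hg : MemLp g 2 (volume.restrict (Ioo 0 l))) (a : ℝ) :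
    IsH1 l (fun x => a + ∫ t in (0 : ℝ)..x, g t) g :=
  ⟨hg, fun x _ => by simp⟩

theorem IsH1.of_hasDerivAt (h : ∀ x, HasDerivAt u (u' x) x) (hu' : Continuous u') :
    IsH1 l u u' := by
  refine ⟨memLp_of_continuousOn_Icc hu'.continuousOn, fun x _ => ?_⟩
  rw [intervalIntegral.integral_eq_sub_of_hasDerivAt (fun t _ => h t) (hu'.intervalIntegrable _ _),
    add_sub_cancel]

theorem IsH1.memLp (hu : IsH1 l u u') : MemLp u 2 (volume.restrict (Ioo 0 l)) :=
  memLp_of_continuousOn_Icc hu.continuousOn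

theorem IsH1.absolutelyContinuousOnInterval (hl : 0 ≤ l) (hu : IsH1 l u u') :
    AbsolutelyContinuousOnInterval (fun x => u 0 + ∫ t in (0 : ℝ)..x, u' t) 0 l :=
  (LipschitzWith.const (u 0)).lipschitzOnWith.absolutelyContinuousOnInterval.fun_add
    ((hu.intervalIntegrable (right_mem_Icc.mpr hl)
      ).absolutelyContinuousOnInterval_intervalIntegral left_mem_uIcc)

theorem IsH1.integral_mul_deriv (hl : 0 < l) (hu : IsH1 l u u') (hv : IsH1 l v v') :
    ∫ x in Ioo 0 l, u x * v' x = u l * v l - u 0 * v 0 - ∫ x in Ioo 0 l, u' x * v x := by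
  have deriv_ae : ∀ {w w' : ℝ → ℝ}, IsH1 l w w' → ∀ᵐ x ∂(volume.restrict (Ioo 0 l)),
      deriv (fun x => w 0 + ∫ t in (0 : ℝ)..x, w' t) x = w' x := by
    intro w w' hw
    filter_upwards [(IsH1.of_primitive hw.1 (w 0)).ae_hasDerivAt hl] with x hx
    exact hx.deriv
  have key := (hu.absolutelyContinuousOnInterval hl.le).integral_mul_deriv_eq_deriv_mul
    (hv.absolutelyContinuousOnInterval hl.le)
  simp only [intervalIntegral.integral_same, add_zero] at key
  rw [← hu.2 l (right_mem_Icc.mpr hl.le), ← hv.2 l (right_mem_Icc.mpr hl.le),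
    ← integral_Ioo_eq_intervalIntegral hl.le, ← integral_Ioo_eq_intervalIntegral hl.le] at key
  convert key using 1
  · refine integral_congr_ae ?_
    filter_upwards [deriv_ae hv, ae_restrict_mem measurableSet_Ioo] with x hdx hx
    rw [hdx, ← hu.2 x (Ioo_subset_Icc_self hx)]
  · congr 1
    refine integral_congr_ae ?_
    filter_upwards [deriv_ae hu, ae_restrict_mem measurableSet_Ioo] with x hdx hx
    rw [hdx, ← hv.2 x (Ioo_subset_Icc_self hx)]

theorem IsH1.sub_eq_intervalIntegral (hu : IsH1 l u u') {s t : ℝ} (hs : s ∈ Icc 0 l)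
    (ht : t ∈ Icc 0 l) : u t - u s = ∫ x in s..t, u' x := by
  rw [hu.2 t ht, hu.2 s hs, add_sub_add_left_eq_sub,
    intervalIntegral.integral_interval_sub_left (hu.intervalIntegrable ht)
      (hu.intervalIntegrable hs)]

theorem IsH1.intervalIntegrable_deriv_sq (hu : IsH1 l u u') {s t : ℝ} (hs : 0 ≤ s) (hst : s ≤ t)
    (ht : t ≤ l) : IntervalIntegrable (fun x => u' x ^ 2) volume s t := by
  rw [intervalIntegrable_iff_integrableOn_Ioo_of_le hst]
  exact IntegrableOn.mono_set hu.1.integrable_sq (Ioo_subset_Ioo hs ht)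

theorem IsH1.sq_sub_le (hu : IsH1 l u u') {s t : ℝ} (hs : 0 ≤ s) (hst : s ≤ t) (ht : t ≤ l) :
    (u t - u s) ^ 2 ≤ (t - s) * ∫ x in s..t, u' x ^ 2 := by
  have hLp : MemLp u' 2 (volume.restrict (Ioo s t)) :=
    hu.1.mono_measure (Measure.restrict_mono (Ioo_subset_Ioo hs ht) le_rfl)
  have := sq_integral_le_measureReal_mul_integral_sq hLp
  rwa [integral_Ioo_eq_intervalIntegral hst, integral_Ioo_eq_intervalIntegral hst,
    ← hu.sub_eq_intervalIntegral ⟨hs, hst.trans ht⟩ ⟨hs.trans hst, ht⟩,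
    measureReal_restrict_apply_univ, Real.volume_real_Ioo_of_le hst] at this

theorem IsH1.integral_sq_le_of_eq_zero (hu : IsH1 l u u') {s t : ℝ} (hs : 0 ≤ s) (hst : s ≤ t)
    (ht : t ≤ l) (hus : u s = 0) :
    ∫ x in s..t, u x ^ 2 ≤ (t - s) ^ 2 * ∫ x in s..t, u' x ^ 2 := by
  have pointwise : ∀ x ∈ Icc s t, u x ^ 2 ≤ (t - s) * ∫ y in s..t, u' y ^ 2 := by
    intro x hx
    have hsx := hu.sq_sub_le hs hx.1 (hx.2.trans ht)
    rw [hus, sub_zero] at hsx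
    refine hsx.trans (mul_le_mul (sub_le_sub_right hx.2 s) ?_ ?_ (sub_nonneg.mpr hst))
    · exact intervalIntegral.integral_mono_interval le_rfl hx.1 hx.2
        (Filter.Eventually.of_forall fun y => sq_nonneg _)
        (hu.intervalIntegrable_deriv_sq hs hst ht)
    · exact intervalIntegral.integral_nonneg hx.1 fun y _ => sq_nonneg _
  have hint : IntervalIntegrable (fun x => u x ^ 2) volume s t :=
    ContinuousOn.intervalIntegrable_of_Icc hst
      ((hu.continuousOn.mono (Icc_subset_Icc hs ht)).pow 2)
  have := intervalIntegral.integral_mono_on hst hint intervalIntegrable_const pointwise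
  rwa [intervalIntegral.integral_const, smul_eq_mul, ← mul_assoc, ← sq] at this

theorem IsH1.sq_mul_integral_sq_le (hl : 0 < l) (hu : IsH1 l u u') {n : ℕ} (hn : 0 < n)
    (hzero : ∀ j < n, u (j * (l / n)) = 0) :
    (n : ℝ) ^ 2 * ∫ x in Ioo 0 l, u x ^ 2 ≤ l ^ 2 * ∫ x in Ioo 0 l, u' x ^ 2 := by
  have : (0 : ℝ) < n := by exact_mod_cast hn
  let p : ℕ → ℝ := fun j => j * (l / n)
  have p_nonneg : ∀ j, 0 ≤ p j := fun j => by positivity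
  have p_succ : ∀ j, p (j + 1) - p j = l / n := fun j => by simp only [p]; push_cast; ring
  have p_mono : ∀ j, p j ≤ p (j + 1) := fun j => sub_nonneg.mp (by rw [p_succ]; positivity)
  have p_last : p n = l := by simp only [p]; field_simp
  have p_le : ∀ j < n, p (j + 1) ≤ l := fun j hj =>
    (monotone_nat_of_le_succ p_mono (Nat.succ_le_of_lt hj)).trans_eq p_last
  have hsum : ∀ f : ℝ → ℝ, (∀ j < n, IntervalIntegrable f volume (p j) (p (j + 1))) →
      ∫ x in Ioo 0 l, f x = ∑ j ∈ Finset.range n, ∫ x in p j..p (j + 1), f x := by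
    intro f hf
    rw [intervalIntegral.sum_integral_adjacent_intervals hf,
      integral_Ioo_eq_intervalIntegral hl.le, p_last]
    simp [p]
  have hu2 : ∀ j < n, IntervalIntegrable (fun x => u x ^ 2) volume (p j) (p (j + 1)) :=
    fun j hj => ContinuousOn.intervalIntegrable_of_Icc (p_mono j)
      ((hu.continuousOn.mono (Icc_subset_Icc (p_nonneg j) (p_le j hj))).pow 2)
  rw [hsum _ hu2, hsum _ fun j hj =>
    hu.intervalIntegrable_deriv_sq (p_nonneg j) (p_mono j) (p_le j hj), Finset.mul_sum,
    Finset.mul_sum]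
  refine Finset.sum_le_sum fun j hj => ?_
  have hj := Finset.mem_range.mp hj
  have hlocal := hu.integral_sq_le_of_eq_zero (p_nonneg j) (p_mono j) (p_le j hj) (hzero j hj)
  rwa [p_succ, div_pow, div_mul_eq_mul_div, le_div_iff₀' (by positivity)] at hlocal

theorem exists_ae_eq_const_of_integral_mul_eq_zero (hl : 0 < l) {g : ℝ → ℝ}
    (hg : MemLp g 2 (volume.restrict (Ioo 0 l)))
    (h : ∀ φ : ℝ → ℝ, MemLp φ 2 (volume.restrict (Ioo 0 l)) → ∫ x in Ioo 0 l, φ x = 0 →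
      ∫ x in Ioo 0 l, g x * φ x = 0) :
    ∃ m : ℝ, g =ᵐ[volume.restrict (Ioo 0 l)] fun _ => m := by
  set m := (∫ x in Ioo 0 l, g x) / l with hm
  have hφ : MemLp (fun x => g x - m) 2 (volume.restrict (Ioo 0 l)) := hg.sub (memLp_const m)
  have mean_zero : ∫ x in Ioo 0 l, (g x - m) = 0 := by
    rw [integral_sub (hg.integrable (by norm_num)) (integrable_const m), integral_const,
      measureReal_restrict_apply_univ, Real.volume_real_Ioo_of_le hl.le, sub_zero, smul_eq_mul, hm,
      mul_div_cancel₀ _ hl.ne', sub_self]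
  have sq_zero : ∫ x in Ioo 0 l, (g x - m) ^ 2 = 0 := by
    have hsq : ∀ x, (g x - m) ^ 2 = g x * (g x - m) - m * (g x - m) := fun x => by ring
    have hmul : Integrable (fun x => g x * (g x - m)) (volume.restrict (Ioo 0 l)) :=
      hg.integrable_mul hφ
    simp only [hsq]
    rw [integral_sub hmul ((hφ.integrable (by norm_num)).const_mul m),
      h _ hφ mean_zero, integral_const_mul, mean_zero, mul_zero, sub_zero]
  refine ⟨m, ?_⟩
  rw [integral_eq_zero_iff_of_nonneg (fun x => sq_nonneg _) hφ.integrable_sq] at sq_zero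
  filter_upwards [sq_zero] with x hx
  exact sub_eq_zero.mp (sq_eq_zero_iff.mp hx)

theorem exists_isH1_ae_eq_of_weak_deriv (hl : 0 < l) {q w' : ℝ → ℝ}
    (hq : MemLp q 2 (volume.restrict (Ioo 0 l))) (hw' : MemLp w' 2 (volume.restrict (Ioo 0 l)))
    (h : ∀ φ φ' : ℝ → ℝ, IsH1 l φ φ' → φ 0 = 0 → φ l = 0 →
      ∫ x in Ioo 0 l, q x * φ' x = -∫ x in Ioo 0 l, w' x * φ x) :
    ∃ w, IsH1 l w w' ∧ q =ᵐ[volume.restrict (Ioo 0 l)] w := by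
  have hW := IsH1.of_primitive hw' 0
  set W : ℝ → ℝ := fun x => 0 + ∫ t in (0 : ℝ)..x, w' t
  obtain ⟨m, hm⟩ := exists_ae_eq_const_of_integral_mul_eq_zero hl (hq.sub hW.memLp)
    fun ψ hψ hψ0 => by
      have hφ := IsH1.of_primitive hψ 0
      have hφ0 : (0 : ℝ) + ∫ t in (0 : ℝ)..0, ψ t = 0 := by simp
      have hφl : 0 + ∫ t in (0 : ℝ)..l, ψ t = 0 := by
        rw [zero_add, ← integral_Ioo_eq_intervalIntegral hl.le, hψ0]
      have hqψ : Integrable (fun x => q x * ψ x) (volume.restrict (Ioo 0 l)) := hq.integrable_mul hψ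
      have hWψ : Integrable (fun x => W x * ψ x) (volume.restrict (Ioo 0 l)) :=
        hW.memLp.integrable_mul hψ
      simp only [Pi.sub_apply, sub_mul]
      rw [integral_sub hqψ hWψ, h _ ψ hφ hφ0 hφl,
        hW.integral_mul_deriv hl hφ, hφ0, hφl]
      ring
  refine ⟨fun x => m + ∫ t in (0 : ℝ)..x, w' t, IsH1.of_primitive hw' m, ?_⟩
  filter_upwards [hm] with x hx
  rw [← hx, Pi.sub_apply]
  simp [W]

end Interval

section Sines

/-- The frequency of the `i`-th Dirichlet eigenfunction `sin (dirichletFreq l i * x)` of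
`(0, l)`. -/
noncomputable def dirichletFreq (l : ℝ) (i : ℕ) : ℝ :=
  ((i : ℝ) + 1) * (Real.pi / l)

variable {l : ℝ}

theorem dirichletFreq_pos (hl : 0 < l) (i : ℕ) : 0 < dirichletFreq l i := by
  have := Real.pi_pos
  unfold dirichletFreq
  positivity

theorem sin_dirichletFreq_mul_self (hl : 0 < l) (i : ℕ) :
    Real.sin (dirichletFreq l i * l) = 0 := by
  have : dirichletFreq l i * l = ((i + 1 : ℕ) : ℝ) * Real.pi := by
    unfold dirichletFreq
    push_cast
    field_simp
  rw [this, Real.sin_nat_mul_pi]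

theorem isH1_sin (l k : ℝ) :
    IsH1 l (fun x => Real.sin (k * x)) (fun x => k * Real.cos (k * x)) :=
  IsH1.of_hasDerivAt (fun x => by simpa [mul_comm] using (hasDerivAt_const_mul k).sin) (by fun_prop)

theorem isH1_cos (l k : ℝ) :
    IsH1 l (fun x => Real.cos (k * x)) (fun x => -k * Real.sin (k * x)) :=
  IsH1.of_hasDerivAt (fun x => by simpa [mul_comm] using (hasDerivAt_const_mul k).cos) (by fun_prop)

theorem integral_cos_int_mul (hl : 0 < l) (m : ℤ) :
    ∫ x in Ioo 0 l, Real.cos (m * (Real.pi / l) * x) = if m = 0 then l else 0 := by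
  rw [integral_Ioo_eq_intervalIntegral hl.le]
  split_ifs with hm
  · simp [hm]
  · have hfreq : (m : ℝ) * (Real.pi / l) ≠ 0 :=
      mul_ne_zero (by exact_mod_cast hm) (div_pos Real.pi_pos hl).ne'
    have hend : (m : ℝ) * (Real.pi / l) * l = m * Real.pi := by field_simp
    rw [intervalIntegral.integral_comp_mul_left _ hfreq, integral_cos, hend, Real.sin_int_mul_pi]
    simp

theorem integral_sin_mul_sin (hl : 0 < l) (i j : ℕ) :
    ∫ x in Ioo 0 l, Real.sin (dirichletFreq l i * x) * Real.sin (dirichletFreq l j * x) =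
      if i = j then l / 2 else 0 := by
  have product_to_sum : ∀ x,
      Real.sin (dirichletFreq l i * x) * Real.sin (dirichletFreq l j * x) =
        1 / 2 * Real.cos (((i - j : ℤ) : ℝ) * (Real.pi / l) * x) -
          1 / 2 * Real.cos (((i + j + 2 : ℤ) : ℝ) * (Real.pi / l) * x) := by
    intro x
    have hsub : ((i - j : ℤ) : ℝ) * (Real.pi / l) * x =
        dirichletFreq l i * x - dirichletFreq l j * x := by
      unfold dirichletFreq; push_cast; ring
    have hadd : ((i + j + 2 : ℤ) : ℝ) * (Real.pi / l) * x =
        dirichletFreq l i * x + dirichletFreq l j * x := by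
      unfold dirichletFreq; push_cast; ring
    rw [hsub, hadd]
    linarith [Real.two_mul_sin_mul_sin (dirichletFreq l i * x) (dirichletFreq l j * x)]
  have hint : ∀ m : ℤ, IntegrableOn (fun x => 1 / 2 * Real.cos (m * (Real.pi / l) * x))
      (Ioo 0 l) := fun m =>
    (Continuous.integrableOn_Icc (by fun_prop)).mono_set Ioo_subset_Icc_self
  simp only [product_to_sum]
  rw [integral_sub (hint _) (hint _), integral_const_mul, integral_const_mul,
    integral_cos_int_mul hl, integral_cos_int_mul hl,
    if_neg (show ¬ ((i : ℤ) + j + 2 = 0) by omega)]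
  simp only [sub_eq_zero, Nat.cast_inj]
  split_ifs <;> ring

theorem integral_cos_mul_cos (hl : 0 < l) (i j : ℕ) :
    ∫ x in Ioo 0 l, Real.cos (dirichletFreq l i * x) * Real.cos (dirichletFreq l j * x) =
      if i = j then l / 2 else 0 := by
  have by_parts := (isH1_cos l (dirichletFreq l i)).integral_mul_deriv hl
    (isH1_sin l (dirichletFreq l j))
  simp only [mul_left_comm _ (dirichletFreq l j), mul_assoc, integral_const_mul, neg_mul,
    integral_neg, integral_sin_mul_sin hl, sin_dirichletFreq_mul_self hl] at by_parts
  have hj := dirichletFreq_pos hl j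
  refine mul_left_cancel₀ hj.ne' (by_parts.trans ?_)
  split_ifs with hij <;> simp [hij]

end Sines

/-! ### Operators on an edge -/

section EdgeOperators

variable {l : ℝ}

/-- The functional `g ↦ ∫₀ᵗ g` on `L²(0, l)`, for `t ∈ [0, l]`, given as the inner product with the
indicator function of `(0, t)`. -/
noncomputable def primitiveAt (l t : ℝ) : IntervalL2 l →L[ℝ] ℝ :=
  innerSL ℝ (indicatorConstLp 2 (measurableSet_Ioo (a := (0 : ℝ)) (b := t))
    (measure_ne_top _ _) (1 : ℝ))

theorem primitiveAt_apply {t : ℝ} (ht : t ∈ Icc 0 l) (g : IntervalL2 l) :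
    primitiveAt l t g = ∫ s in (0 : ℝ)..t, g s := by
  rw [primitiveAt, innerSL_apply_apply, L2.inner_indicatorConstLp_one,
    Measure.restrict_restrict measurableSet_Ioo,
    inter_eq_left.mpr (Ioo_subset_Ioo_right ht.2), integral_Ioo_eq_intervalIntegral ht.1]

theorem abs_primitiveAt_le (l t : ℝ) (g : IntervalL2 l) :
    |primitiveAt l t g| ≤ (volume.restrict (Ioo (0 : ℝ) l)).real univ ^ (1 / 2 : ℝ) * ‖g‖ := by
  rw [primitiveAt, innerSL_apply_apply]
  refine (abs_real_inner_le_norm _ _).trans ?_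
  gcongr
  refine norm_indicatorConstLp_le.trans ?_
  simp only [norm_one, one_mul, ENNReal.toReal_ofNat]
  gcongr
  · exact measure_ne_top _ _
  · exact subset_univ _

theorem memLp_primitive (g : IntervalL2 l) :
    MemLp (fun x => ∫ t in (0 : ℝ)..x, g t) 2 (volume.restrict (Ioo 0 l)) := by
  simpa using (IsH1.of_primitive (Lp.memLp g) 0).memLp

/-- The Volterra operator `g ↦ ∫₀ˣ g` on `L²(0, l)`. -/
noncomputable def volterra (l : ℝ) : IntervalL2 l →L[ℝ] IntervalL2 l :=
  LinearMap.mkContinuous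
    { toFun := fun g => (memLp_primitive g).toLp
      map_add' := fun f g => by
        rw [← MemLp.toLp_add]
        refine MemLp.toLp_congr _ _ ?_
        filter_upwards [ae_restrict_mem measurableSet_Ioo] with x hx
        simp only [Pi.add_apply, ← primitiveAt_apply (Ioo_subset_Icc_self hx), map_add]
      map_smul' := fun r g => by
        rw [RingHom.id_apply, ← MemLp.toLp_const_smul]
        refine MemLp.toLp_congr _ _ ?_
        filter_upwards [ae_restrict_mem measurableSet_Ioo] with x hx
        simp only [Pi.smul_apply, ← primitiveAt_apply (Ioo_subset_Icc_self hx), map_smul] }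
    (measureUnivNNReal (volume.restrict (Ioo (0 : ℝ) l)) ^ (2 : ENNReal).toReal⁻¹ *
      (volume.restrict (Ioo (0 : ℝ) l)).real univ ^ (1 / 2 : ℝ)) (fun g => by
      rw [mul_assoc]
      refine Lp.norm_le_of_ae_bound (by positivity) ?_
      filter_upwards [(memLp_primitive g).coeFn_toLp, ae_restrict_mem measurableSet_Ioo]
        with x hx hm
      change ‖((memLp_primitive g).toLp : ℝ → ℝ) x‖ ≤ _
      rw [hx, ← primitiveAt_apply (Ioo_subset_Icc_self hm)]
      exact abs_primitiveAt_le l x g)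

theorem volterra_ae_eq (g : IntervalL2 l) :
    volterra l g =ᵐ[volume.restrict (Ioo (0 : ℝ) l)] fun x => ∫ t in (0 : ℝ)..x, g t :=
  (memLp_primitive g).coeFn_toLp

/-- Multiplication by a bounded function as an operator on `L²(0, l)`. -/
noncomputable def mulBounded {c : ℝ → ℝ} (hc : MemLp c ⊤ (volume.restrict (Ioo (0 : ℝ) l))) :
    IntervalL2 l →L[ℝ] IntervalL2 l :=
  (ContinuousLinearMap.mul ℝ ℝ).holderL (volume.restrict (Ioo (0 : ℝ) l)) ⊤ 2 2 hc.toLp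

theorem mulBounded_ae_eq {c : ℝ → ℝ} (hc : MemLp c ⊤ (volume.restrict (Ioo (0 : ℝ) l)))
    (g : IntervalL2 l) :
    mulBounded hc g =ᵐ[volume.restrict (Ioo (0 : ℝ) l)] fun x => c x * g x := by
  filter_upwards [(ContinuousLinearMap.mul ℝ ℝ).coeFn_holder (r := 2) hc.toLp g, hc.coeFn_toLp]
    with x hx hcx
  rw [← hcx]
  exact hx

end EdgeOperators

namespace MetricGraph

variable {V : Type*} {G : SimpleGraph V} (Γ : MetricGraph G)

/-! ### Boundary values on a metric graph -/

section Boundary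

theorem src_ne_tgt (e : G.edgeSet) : Γ.src e ≠ Γ.tgt e := by
  have h := e.2
  rw [← Γ.ends e, SimpleGraph.mem_edgeSet] at h
  exact h.ne

theorem mem_edge_iff (e : G.edgeSet) (v : V) :
    v ∈ (e : Sym2 V) ↔ v = Γ.src e ∨ v = Γ.tgt e := by
  rw [← Γ.ends e, Sym2.mem_iff]

theorem coord_src (e : G.edgeSet) : Γ.coord e (Γ.src e) = 0 := by
  simp [coord]

theorem coord_tgt (e : G.edgeSet) : Γ.coord e (Γ.tgt e) = Γ.length e := by
  simp [coord, (Γ.src_ne_tgt e).symm]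

theorem coord_mem_Icc (e : G.edgeSet) (v : V) : Γ.coord e v ∈ Icc 0 (Γ.length e) := by
  have hl := (Γ.length_pos e).le
  unfold coord
  split_ifs
  exacts [left_mem_Icc.mpr hl, right_mem_Icc.mpr hl]

theorem VertexContinuous.exists_vertex_values {Γ : MetricGraph G} {u : G.edgeSet → ℝ → ℝ}
    (h : Γ.VertexContinuous u) :
    ∃ φ : V → ℝ, ∀ e, u e 0 = φ (Γ.src e) ∧ u e (Γ.length e) = φ (Γ.tgt e) := by
  classical
  let φ : V → ℝ := fun v => if hv : ∃ e : G.edgeSet, v ∈ (e : Sym2 V) then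
    u hv.choose (Γ.coord hv.choose v) else 0
  have hφ : ∀ (e : G.edgeSet) (v : V), v ∈ (e : Sym2 V) → u e (Γ.coord e v) = φ v := by
    intro e v hv
    have hv' : ∃ e : G.edgeSet, v ∈ (e : Sym2 V) := ⟨e, hv⟩
    simp only [φ, dif_pos hv']
    exact h v e _ hv hv'.choose_spec
  refine ⟨φ, fun e => ⟨?_, ?_⟩⟩
  · rw [← hφ e _ ((Γ.mem_edge_iff e _).mpr (Or.inl rfl)), coord_src]
  · rw [← hφ e _ ((Γ.mem_edge_iff e _).mpr (Or.inr rfl)), coord_tgt]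

theorem vertexContinuous_of_vertex_values {u : G.edgeSet → ℝ → ℝ} {φ : V → ℝ}
    (h : ∀ e, u e 0 = φ (Γ.src e) ∧ u e (Γ.length e) = φ (Γ.tgt e)) : Γ.VertexContinuous u := by
  have hφ : ∀ (v : V) (e : G.edgeSet), v ∈ (e : Sym2 V) → u e (Γ.coord e v) = φ v := by
    intro v e hv
    rcases (Γ.mem_edge_iff e v).mp hv with rfl | rfl
    · rw [coord_src, (h e).1]
    · rw [coord_tgt, (h e).2]
  intro v e₁ e₂ h₁ h₂
  rw [hφ v e₁ h₁, hφ v e₂ h₂]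

open Classical in
/-- The net flux `∑ c_e(v) u_e'(v)` out of the vertex `v`, which the Kirchhoff condition requires
to vanish. -/
noncomputable def netFlux [Fintype G.edgeSet] (c u' : G.edgeSet → ℝ → ℝ) (v : V) : ℝ :=
  ∑ e ∈ Finset.univ.filter (fun e : G.edgeSet => v ∈ (e : Sym2 V)),
    c e (Γ.coord e v) * Γ.outwardDeriv e v (u' e)

open Classical in
theorem vertex_flux_term_eq (c u' : G.edgeSet → ℝ → ℝ) (e : G.edgeSet) (v : V) :
    (if v ∈ (e : Sym2 V) then c e (Γ.coord e v) * Γ.outwardDeriv e v (u' e) else 0) =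
      (if v = Γ.src e then c e 0 * u' e 0 else 0) -
        (if v = Γ.tgt e then c e (Γ.length e) * u' e (Γ.length e) else 0) := by
  have hne := Γ.src_ne_tgt e
  simp only [Γ.mem_edge_iff e v]
  rcases eq_or_ne v (Γ.src e) with rfl | hsrc
  · simp [hne, coord_src, outwardDeriv]
  rcases eq_or_ne v (Γ.tgt e) with rfl | htgt
  · simp [hne.symm, coord_tgt, outwardDeriv]
  · simp [hsrc, htgt]

theorem sum_boundary_eq_neg_sum_netFlux [Fintype G.edgeSet] (c u' : G.edgeSet → ℝ → ℝ)
    (φ : V → ℝ) {S : Finset V} (hS : ∀ e, Γ.src e ∈ S ∧ Γ.tgt e ∈ S) :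
    ∑ e, (c e (Γ.length e) * u' e (Γ.length e) * φ (Γ.tgt e) - c e 0 * u' e 0 * φ (Γ.src e)) =
      -∑ v ∈ S, φ v * Γ.netFlux c u' v := by
  classical
  simp only [netFlux, Finset.mul_sum, Finset.sum_filter, vertex_flux_term_eq]
  rw [Finset.sum_comm, ← Finset.sum_neg_distrib]
  refine Finset.sum_congr rfl fun e _ => ?_
  simp only [mul_sub, mul_ite, mul_zero, Finset.sum_sub_distrib, Finset.sum_ite_eq', hS,
    if_true]
  ring

end Boundary

/-! ### The form domain -/

section FormDomain

/-- The functions on the edges that are `H¹` on every edge, without conditions at the vertices. Such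
a function is encoded by its initial values and its derivatives. -/
abbrev EdgewiseH1 : Type _ :=
  WithLp 2 (EuclideanSpace ℝ G.edgeSet × Γ.StateSpace)

variable {Γ}

/-- The continuous representative of an edgewise `H¹` function. -/
noncomputable def rep (x : Γ.EdgewiseH1) (e : G.edgeSet) (t : ℝ) : ℝ :=
  x.fst e + ∫ s in (0 : ℝ)..t, x.snd e s

theorem isH1_rep (x : Γ.EdgewiseH1) (e : G.edgeSet) :
    IsH1 (Γ.length e) (rep x e) (x.snd e) :=
  IsH1.of_primitive (Lp.memLp _) _

/-- The edgewise `H¹` function with given representatives and derivatives on the edges. -/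
noncomputable def ofIsH1 {u u' : G.edgeSet → ℝ → ℝ}
    (hu : ∀ e, IsH1 (Γ.length e) (u e) (u' e)) : Γ.EdgewiseH1 :=
  WithLp.toLp 2 (WithLp.toLp 2 fun e => u e 0, WithLp.toLp 2 fun e => (hu e).1.toLp)

section OfIsH1

variable {u u' : G.edgeSet → ℝ → ℝ} (hu : ∀ e, IsH1 (Γ.length e) (u e) (u' e)) (e : G.edgeSet)

theorem ofIsH1_snd_ae_eq :
    (ofIsH1 hu).snd e =ᵐ[volume.restrict (Ioo 0 (Γ.length e))] u' e :=
  (hu e).1.coeFn_toLp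

theorem rep_ofIsH1 {t : ℝ} (ht : t ∈ Icc 0 (Γ.length e)) : rep (ofIsH1 hu) e t = u e t := by
  rw [(hu e).2 t ht, ← intervalIntegral_congr_of_ae (ofIsH1_snd_ae_eq hu e) ht]
  rfl

theorem rep_ofIsH1_ae_eq :
    rep (ofIsH1 hu) e =ᵐ[volume.restrict (Ioo 0 (Γ.length e))] u e := by
  filter_upwards [ae_restrict_mem measurableSet_Ioo] with t ht
  exact rep_ofIsH1 hu e (Ioo_subset_Icc_self ht)

end OfIsH1

variable (Γ)

/-- Evaluation of edgewise `H¹` functions at the point `t` of the edge `e`. -/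
noncomputable def evalAt (e : G.edgeSet) (t : ℝ) : Γ.EdgewiseH1 →L[ℝ] ℝ :=
  EuclideanSpace.proj e ∘L WithLp.fstL 2 ℝ _ _ +
    (primitiveAt (Γ.length e) t ∘L PiLp.proj 2 _ e) ∘L WithLp.sndL 2 ℝ _ _

theorem evalAt_apply (e : G.edgeSet) {t : ℝ} (ht : t ∈ Icc 0 (Γ.length e)) (x : Γ.EdgewiseH1) :
    Γ.evalAt e t x = rep x e t := by
  rw [rep, ← primitiveAt_apply ht]
  rfl

/-- The form domain: the edgewise `H¹` functions that are continuous at the vertices. -/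
noncomputable def formDomain : Submodule ℝ Γ.EdgewiseH1 :=
  ⨅ (v : V) (e₁ : G.edgeSet) (e₂ : G.edgeSet) (_ : v ∈ (e₁ : Sym2 V)) (_ : v ∈ (e₂ : Sym2 V)),
    (Γ.evalAt e₁ (Γ.coord e₁ v) - Γ.evalAt e₂ (Γ.coord e₂ v)).ker

theorem mem_formDomain {x : Γ.EdgewiseH1} :
    x ∈ Γ.formDomain ↔ Γ.VertexContinuous (rep x) := by
  simp only [formDomain, Submodule.mem_iInf, LinearMap.mem_ker, VertexContinuous,
    ContinuousLinearMap.coe_coe, _root_.sub_apply, sub_eq_zero,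
    Γ.evalAt_apply _ (Γ.coord_mem_Icc _ _)]

theorem isClosed_formDomain : IsClosed (Γ.formDomain : Set Γ.EdgewiseH1) := by
  simp only [formDomain, Submodule.coe_iInf]
  refine isClosed_iInter fun v => isClosed_iInter fun e₁ => isClosed_iInter fun e₂ =>
    isClosed_iInter fun _ => isClosed_iInter fun _ => ?_
  exact (Γ.evalAt e₁ (Γ.coord e₁ v) - Γ.evalAt e₂ (Γ.coord e₂ v)).isClosed_ker

instance : CompleteSpace Γ.formDomain :=
  Γ.isClosed_formDomain.completeSpace_coe

/-- The element of the form domain with given representatives and derivatives on the edges. -/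
noncomputable def domainOfIsH1 {u u' : G.edgeSet → ℝ → ℝ}
    (hu : ∀ e, IsH1 (Γ.length e) (u e) (u' e)) (h : Γ.VertexContinuous u) : Γ.formDomain :=
  ⟨ofIsH1 hu, by
    rw [mem_formDomain]
    intro v e₁ e₂ h₁ h₂
    rw [rep_ofIsH1 hu _ (Γ.coord_mem_Icc _ _), rep_ofIsH1 hu _ (Γ.coord_mem_Icc _ _)]
    exact h v e₁ e₂ h₁ h₂⟩

/-- Differentiation of functions in the form domain. -/
noncomputable def edgeDeriv : Γ.formDomain →L[ℝ] Γ.StateSpace :=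
  WithLp.sndL 2 ℝ (EuclideanSpace ℝ G.edgeSet) Γ.StateSpace ∘L Γ.formDomain.subtypeL

theorem edgeDeriv_domainOfIsH1_ae_eq {u u' : G.edgeSet → ℝ → ℝ}
    (hu : ∀ e, IsH1 (Γ.length e) (u e) (u' e)) (h : Γ.VertexContinuous u) (e : G.edgeSet) :
    Γ.edgeDeriv (Γ.domainOfIsH1 hu h) e =ᵐ[volume.restrict (Ioo 0 (Γ.length e))] u' e :=
  ofIsH1_snd_ae_eq hu e

end FormDomain

/-! ### The embedding into the state space -/

section Embedding

/-- Assembling a function on the graph from its restrictions to the edges. -/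
noncomputable def ofEdges : (∀ e : G.edgeSet, IntervalL2 (Γ.length e)) →L[ℝ] Γ.StateSpace :=
  (PiLp.continuousLinearEquiv 2 ℝ fun e : G.edgeSet =>
    IntervalL2 (Γ.length e)).symm.toContinuousLinearMap

/-- The direct sum of operators on the edges. -/
noncomputable def edgewiseMap
    (T : ∀ e : G.edgeSet, IntervalL2 (Γ.length e) →L[ℝ] IntervalL2 (Γ.length e)) :
    Γ.StateSpace →L[ℝ] Γ.StateSpace :=
  Γ.ofEdges ∘L ContinuousLinearMap.pi fun e => T e ∘L PiLp.proj 2 _ e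

theorem edgewiseMap_apply
    (T : ∀ e : G.edgeSet, IntervalL2 (Γ.length e) →L[ℝ] IntervalL2 (Γ.length e))
    (f : Γ.StateSpace) (e : G.edgeSet) : Γ.edgewiseMap T f e = T e (f e) := rfl

/-- The inclusion of the functions that are constant on every edge. -/
noncomputable def edgewiseConst : EuclideanSpace ℝ G.edgeSet →L[ℝ] Γ.StateSpace :=
  Γ.ofEdges ∘L ContinuousLinearMap.pi fun e =>
    Lp.constL 2 (volume.restrict (Ioo (0 : ℝ) (Γ.length e))) ℝ ∘L EuclideanSpace.proj e

theorem edgewiseConst_injective : Function.Injective Γ.edgewiseConst := by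
  intro a b hab
  ext e
  have : NeZero (volume.restrict (Ioo 0 (Γ.length e))) :=
    ⟨by simp [Measure.restrict_eq_zero, Γ.length_pos e]⟩
  have h : Lp.const 2 (volume.restrict (Ioo 0 (Γ.length e))) (a e) =
      Lp.const 2 (volume.restrict (Ioo 0 (Γ.length e))) (b e) :=
    congrFun (congrArg WithLp.ofLp hab) e
  have ha := Lp.coeFn_const (μ := volume.restrict (Ioo 0 (Γ.length e))) (p := 2) (c := a e)
  have hb := Lp.coeFn_const (μ := volume.restrict (Ioo 0 (Γ.length e))) (p := 2) (c := b e)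
  rw [h] at ha
  obtain ⟨_, ht⟩ := (ha.symm.trans hb).exists
  exact ht

variable [Fintype G.edgeSet]

/-- The inclusion of the edgewise `H¹` functions into the state space. -/
noncomputable def embedH1 : Γ.EdgewiseH1 →L[ℝ] Γ.StateSpace :=
  Γ.edgewiseConst ∘L WithLp.fstL 2 ℝ _ _ +
    Γ.edgewiseMap (fun e => volterra (Γ.length e)) ∘L WithLp.sndL 2 ℝ _ _

theorem embedH1_ae_eq (x : Γ.EdgewiseH1) (e : G.edgeSet) :
    Γ.embedH1 x e =ᵐ[volume.restrict (Ioo 0 (Γ.length e))] rep x e := by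
  have h : Γ.embedH1 x e = Lp.const 2 _ (x.fst e) + volterra (Γ.length e) (x.snd e) := rfl
  rw [h]
  filter_upwards [Lp.coeFn_add (Lp.const 2 (volume.restrict (Ioo 0 (Γ.length e))) (x.fst e))
    (volterra (Γ.length e) (x.snd e)), volterra_ae_eq (x.snd e),
    Lp.coeFn_const (μ := volume.restrict (Ioo 0 (Γ.length e))) (p := 2) (c := x.fst e)]
    with t hadd hvolterra hconst
  rw [hadd, Pi.add_apply, hvolterra, hconst]
  rfl

/-- The inclusion of the form domain into the state space. -/
noncomputable def embed : Γ.formDomain →L[ℝ] Γ.StateSpace :=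
  Γ.embedH1 ∘L Γ.formDomain.subtypeL

theorem exists_norm_fst_le :
    ∃ K ≥ 0, ∀ x : Γ.EdgewiseH1, ‖x.fst‖ ≤ K * (‖x.snd‖ + ‖Γ.embedH1 x‖) := by
  obtain ⟨K, -, hK⟩ := (Γ.edgewiseConst : EuclideanSpace ℝ G.edgeSet →ₗ[ℝ]
    Γ.StateSpace).exists_antilipschitzWith (LinearMap.ker_eq_bot.mpr Γ.edgewiseConst_injective)
  let I : Γ.StateSpace →L[ℝ] Γ.StateSpace := Γ.edgewiseMap fun e => volterra (Γ.length e)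
  refine ⟨K * (1 + ‖I‖), by positivity, fun x => ?_⟩
  have hconst : Γ.edgewiseConst x.fst = Γ.embedH1 x - I x.snd := by
    rw [eq_sub_iff_add_eq]
    rfl
  calc ‖x.fst‖ ≤ K * ‖Γ.edgewiseConst x.fst‖ := by simpa using hK.le_mul_dist x.fst 0
    _ = K * ‖Γ.embedH1 x - I x.snd‖ := by rw [hconst]
    _ ≤ K * (‖Γ.embedH1 x‖ + ‖I‖ * ‖x.snd‖) := by
        gcongr
        exact (norm_sub_le _ _).trans (by gcongr; exact I.le_opNorm _)
    _ ≤ K * (1 + ‖I‖) * (‖x.snd‖ + ‖Γ.embedH1 x‖) := by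
        rw [mul_assoc]
        gcongr
        nlinarith [norm_nonneg x.snd, mul_nonneg (norm_nonneg I) (norm_nonneg (Γ.embedH1 x))]

theorem exists_norm_le :
    ∃ C > 0, ∀ x : Γ.EdgewiseH1, ‖x‖ ≤ C * (‖x.snd‖ + ‖Γ.embedH1 x‖) := by
  obtain ⟨K, hK, hfst⟩ := Γ.exists_norm_fst_le
  refine ⟨K + 1, by positivity, fun x => ?_⟩
  have hx : ‖x‖ ≤ ‖x.fst‖ + ‖x.snd‖ := by
    have h := WithLp.prod_norm_sq_eq_of_L2 x
    refine abs_le_of_sq_le_sq' ?_ (by positivity) |>.2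
    nlinarith [mul_nonneg (norm_nonneg x.fst) (norm_nonneg x.snd)]
  linarith [hfst x, norm_nonneg (Γ.embedH1 x)]

end Embedding

end MetricGraph

/-! ### The form and Green's formula -/

theorem integrableOn_mul_mul {l : ℝ} {c f g : ℝ → ℝ} (hc : MemLp c ⊤ (volume.restrict (Ioo 0 l)))
    (hf : MemLp f 2 (volume.restrict (Ioo 0 l))) (hg : MemLp g 2 (volume.restrict (Ioo 0 l))) :
    IntegrableOn (fun t => c t * f t * g t) (Ioo 0 l) := by
  have hcf : MemLp (fun t => c t * f t) 2 (volume.restrict (Ioo 0 l)) := hf.mul hc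
  exact hcf.integrable_mul hg

theorem green_interval {l : ℝ} (hl : 0 < l) {c p h u g y y' w w' : ℝ → ℝ}
    (hp : MemLp p ⊤ (volume.restrict (Ioo 0 l))) (hu : MemLp u 2 (volume.restrict (Ioo 0 l)))
    (hy : IsH1 l y y') (hw : IsH1 l w w')
    (hwc : (fun t => c t * g t) =ᵐ[volume.restrict (Ioo 0 l)] w)
    (hh : h =ᵐ[volume.restrict (Ioo 0 l)] fun t => w' t - p t * u t) :
    (∫ t in Ioo 0 l, c t * g t * y' t) + ∫ t in Ioo 0 l, p t * u t * y t =
      -(∫ t in Ioo 0 l, h t * y t) + (w l * y l - w 0 * y 0) := by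
  have hflux : ∫ t in Ioo 0 l, c t * g t * y' t = ∫ t in Ioo 0 l, w t * y' t := by
    refine integral_congr_ae ?_
    filter_upwards [hwc] with t ht
    rw [ht]
  have hrhs : ∫ t in Ioo 0 l, h t * y t =
      (∫ t in Ioo 0 l, w' t * y t) - ∫ t in Ioo 0 l, p t * u t * y t := by
    have hint : IntegrableOn (fun t => w' t * y t) (Ioo 0 l) := hw.1.integrable_mul hy.memLp
    rw [← integral_sub hint (integrableOn_mul_mul hp hu hy.memLp)]
    refine integral_congr_ae ?_
    filter_upwards [hh] with t ht
    rw [ht]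
    ring
  rw [hflux, hrhs, hw.integral_mul_deriv hl hy]
  ring

namespace MetricGraph

variable {V : Type*} {G : SimpleGraph V} [Fintype G.edgeSet] (Γ : MetricGraph G)

theorem inner_eq_sum (f g : Γ.StateSpace) :
    inner ℝ f g = ∑ e, ∫ t in Ioo 0 (Γ.length e), f e t * g e t := by
  rw [PiLp.inner_apply]
  refine Finset.sum_congr rfl fun e _ => ?_
  rw [L2.inner_def]
  refine integral_congr_ae (Filter.Eventually.of_forall fun t => ?_)
  simp [mul_comm]

theorem norm_sq_eq_sum (f : Γ.StateSpace) :
    ‖f‖ ^ 2 = ∑ e, ∫ t in Ioo 0 (Γ.length e), f e t ^ 2 := by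
  rw [← real_inner_self_eq_norm_sq, inner_eq_sum]
  simp only [sq]

theorem embed_ae_eq (x : Γ.formDomain) (e : G.edgeSet) :
    Γ.embed x e =ᵐ[volume.restrict (Ioo 0 (Γ.length e))] rep x.1 e :=
  Γ.embedH1_ae_eq x.1 e

theorem inner_embed (f : Γ.StateSpace) (y : Γ.formDomain) :
    inner ℝ f (Γ.embed y) = ∑ e, ∫ t in Ioo 0 (Γ.length e), f e t * rep y.1 e t := by
  rw [inner_eq_sum]
  refine Finset.sum_congr rfl fun e _ => integral_congr_ae ?_
  filter_upwards [Γ.embed_ae_eq y e] with t ht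
  rw [ht]

section Form

variable {c p : G.edgeSet → ℝ → ℝ}
  (hc : ∀ e, MemLp (c e) ⊤ (volume.restrict (Ioo 0 (Γ.length e))))
  (hp : ∀ e, MemLp (p e) ⊤ (volume.restrict (Ioo 0 (Γ.length e))))

/-- The form `∑ₑ ∫ c u' v' + p u v` on the form domain. -/
noncomputable def form : Γ.formDomain →L[ℝ] Γ.formDomain →L[ℝ] ℝ :=
  let innerForm : Γ.StateSpace →L[ℝ] Γ.StateSpace →L[ℝ] ℝ := innerSL ℝ
  innerForm.bilinearComp (Γ.edgewiseMap (fun e => mulBounded (hc e)) ∘L Γ.edgeDeriv) Γ.edgeDeriv +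
    innerForm.bilinearComp (Γ.edgewiseMap (fun e => mulBounded (hp e)) ∘L Γ.embed) Γ.embed

theorem form_apply (x y : Γ.formDomain) :
    Γ.form hc hp x y =
      inner ℝ (Γ.edgewiseMap (fun e => mulBounded (hc e)) (Γ.edgeDeriv x)) (Γ.edgeDeriv y) +
        inner ℝ (Γ.edgewiseMap (fun e => mulBounded (hp e)) (Γ.embed x)) (Γ.embed y) := rfl

theorem form_eq_sum (x y : Γ.formDomain) :
    Γ.form hc hp x y =
      ∑ e, ((∫ t in Ioo 0 (Γ.length e), c e t * Γ.edgeDeriv x e t * Γ.edgeDeriv y e t) +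
        ∫ t in Ioo 0 (Γ.length e), p e t * rep x.1 e t * rep y.1 e t) := by
  rw [form_apply, inner_eq_sum, inner_embed, ← Finset.sum_add_distrib]
  refine Finset.sum_congr rfl fun e _ => ?_
  congr 1 <;> refine integral_congr_ae ?_
  · filter_upwards [mulBounded_ae_eq (hc e) (Γ.edgeDeriv x e)] with t ht
    rw [edgewiseMap_apply, ht]
  · filter_upwards [mulBounded_ae_eq (hp e) (Γ.embed x e), Γ.embed_ae_eq x e] with t ht hxt
    rw [edgewiseMap_apply, ht, hxt]

theorem form_symm (x y : Γ.formDomain) : Γ.form hc hp x y = Γ.form hc hp y x := by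
  rw [form_eq_sum, form_eq_sum]
  refine Finset.sum_congr rfl fun e _ => ?_
  congr 1 <;> exact integral_congr_ae (Filter.Eventually.of_forall fun t => mul_right_comm _ _ _)

theorem mul_norm_edgeDeriv_sq_le_form {c₀ : ℝ}
    (hcpos : ∀ e, ∀ᵐ t ∂(volume.restrict (Ioo 0 (Γ.length e))), c₀ ≤ c e t)
    (hpnonneg : ∀ e, ∀ᵐ t ∂(volume.restrict (Ioo 0 (Γ.length e))), 0 ≤ p e t)
    (x : Γ.formDomain) : c₀ * ‖Γ.edgeDeriv x‖ ^ 2 ≤ Γ.form hc hp x x := by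
  rw [form_eq_sum, norm_sq_eq_sum, Finset.mul_sum]
  refine Finset.sum_le_sum fun e _ => ?_
  have hpotential : 0 ≤ ∫ t in Ioo 0 (Γ.length e), p e t * rep x.1 e t * rep x.1 e t := by
    refine integral_nonneg_of_ae ?_
    filter_upwards [hpnonneg e] with t ht
    simpa only [Pi.zero_apply, mul_assoc] using mul_nonneg ht (mul_self_nonneg (rep x.1 e t))
  have hkinetic : c₀ * ∫ t in Ioo 0 (Γ.length e), Γ.edgeDeriv x e t ^ 2 ≤
      ∫ t in Ioo 0 (Γ.length e), c e t * Γ.edgeDeriv x e t * Γ.edgeDeriv x e t := by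
    rw [← integral_const_mul]
    refine integral_mono_ae ((Lp.memLp _).integrable_sq.const_mul _)
      (integrableOn_mul_mul (hc e) (Lp.memLp _) (Lp.memLp _)) ?_
    filter_upwards [hcpos e] with t ht
    rw [mul_assoc, sq]
    exact mul_le_mul_of_nonneg_right ht (mul_self_nonneg _)
  linarith

theorem exists_form_self_le : ∃ K ≥ 0, ∀ x : Γ.formDomain,
    Γ.form hc hp x x ≤ K * (‖Γ.edgeDeriv x‖ ^ 2 + ‖Γ.embed x‖ ^ 2) := by
  let M := Γ.edgewiseMap fun e => mulBounded (hc e)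
  let N := Γ.edgewiseMap fun e => mulBounded (hp e)
  have hle : ∀ (T : Γ.StateSpace →L[ℝ] Γ.StateSpace) (f : Γ.StateSpace),
      inner ℝ (T f) f ≤ ‖T‖ * ‖f‖ ^ 2 := by
    intro T f
    refine (real_inner_le_norm _ _).trans ?_
    rw [sq, ← mul_assoc]
    gcongr
    exact T.le_opNorm f
  refine ⟨‖M‖ + ‖N‖, by positivity, fun x => ?_⟩
  calc Γ.form hc hp x x ≤ ‖M‖ * ‖Γ.edgeDeriv x‖ ^ 2 + ‖N‖ * ‖Γ.embed x‖ ^ 2 :=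
        add_le_add (hle M _) (hle N _)
    _ ≤ (‖M‖ + ‖N‖) * ‖Γ.edgeDeriv x‖ ^ 2 + (‖M‖ + ‖N‖) * ‖Γ.embed x‖ ^ 2 := by
        gcongr
        · exact le_add_of_nonneg_right (norm_nonneg _)
        · exact le_add_of_nonneg_left (norm_nonneg _)
    _ = (‖M‖ + ‖N‖) * (‖Γ.edgeDeriv x‖ ^ 2 + ‖Γ.embed x‖ ^ 2) := by ring

theorem exists_coercive {c₀ : ℝ} (hc₀ : 0 < c₀)
    (hcpos : ∀ e, ∀ᵐ t ∂(volume.restrict (Ioo 0 (Γ.length e))), c₀ ≤ c e t)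
    (hpnonneg : ∀ e, ∀ᵐ t ∂(volume.restrict (Ioo 0 (Γ.length e))), 0 ≤ p e t) :
    ∃ δ > 0, ∀ x : Γ.formDomain,
      δ * ‖x‖ * ‖x‖ ≤ Γ.form hc hp x x + inner ℝ (Γ.embed x) (Γ.embed x) := by
  obtain ⟨C, hC, hnorm⟩ := Γ.exists_norm_le
  have : 0 < min c₀ 1 := lt_min hc₀ one_pos
  refine ⟨min c₀ 1 / (2 * C ^ 2), by positivity, fun x => ?_⟩
  have hx : ‖x‖ ≤ C * (‖Γ.edgeDeriv x‖ + ‖Γ.embed x‖) := hnorm x.1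
  have hsq : ‖x‖ * ‖x‖ ≤ 2 * C ^ 2 * (‖Γ.edgeDeriv x‖ ^ 2 + ‖Γ.embed x‖ ^ 2) := by
    calc ‖x‖ * ‖x‖
      _ ≤ (C * (‖Γ.edgeDeriv x‖ + ‖Γ.embed x‖)) * (C * (‖Γ.edgeDeriv x‖ + ‖Γ.embed x‖)) := by
          gcongr
      _ = C ^ 2 * (‖Γ.edgeDeriv x‖ + ‖Γ.embed x‖) ^ 2 := by ring
      _ ≤ C ^ 2 * (2 * (‖Γ.edgeDeriv x‖ ^ 2 + ‖Γ.embed x‖ ^ 2)) := by gcongr; exact add_sq_le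
      _ = _ := by ring
  rw [real_inner_self_eq_norm_sq, mul_assoc]
  calc min c₀ 1 / (2 * C ^ 2) * (‖x‖ * ‖x‖)
      ≤ min c₀ 1 / (2 * C ^ 2) * (2 * C ^ 2 * (‖Γ.edgeDeriv x‖ ^ 2 + ‖Γ.embed x‖ ^ 2)) := by gcongr
    _ = min c₀ 1 * ‖Γ.edgeDeriv x‖ ^ 2 + min c₀ 1 * ‖Γ.embed x‖ ^ 2 := by field_simp
    _ ≤ c₀ * ‖Γ.edgeDeriv x‖ ^ 2 + 1 * ‖Γ.embed x‖ ^ 2 := by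
        gcongr
        exacts [min_le_left _ _, min_le_right _ _]
    _ ≤ Γ.form hc hp x x + ‖Γ.embed x‖ ^ 2 := by
        rw [one_mul]
        gcongr
        exact Γ.mul_norm_edgeDeriv_sq_le_form hc hp hcpos hpnonneg x

theorem form_eq_neg_inner_sub_sum_netFlux {x y : Γ.formDomain} {h : Γ.StateSpace}
    {u' w w' : G.edgeSet → ℝ → ℝ}
    (hx : ∀ e, Γ.edgeDeriv x e =ᵐ[volume.restrict (Ioo 0 (Γ.length e))] u' e)
    (hw : ∀ e, IsH1 (Γ.length e) (w e) (w' e))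
    (hwc : ∀ e, ∀ t ∈ Icc 0 (Γ.length e), w e t = c e t * u' e t)
    (hh : ∀ e, h e =ᵐ[volume.restrict (Ioo 0 (Γ.length e))]
      fun t => w' e t - p e t * rep x.1 e t) {φ : V → ℝ}
    (hy : ∀ e, rep y.1 e 0 = φ (Γ.src e) ∧ rep y.1 e (Γ.length e) = φ (Γ.tgt e))
    {S : Finset V} (hS : ∀ e, Γ.src e ∈ S ∧ Γ.tgt e ∈ S) :
    Γ.form hc hp x y = -inner ℝ h (Γ.embed y) - ∑ v ∈ S, φ v * Γ.netFlux c u' v := by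
  rw [sub_eq_add_neg, ← Γ.sum_boundary_eq_neg_sum_netFlux c u' φ hS, inner_embed, form_eq_sum,
    ← Finset.sum_neg_distrib, ← Finset.sum_add_distrib]
  refine Finset.sum_congr rfl fun e _ => ?_
  have hl := Γ.length_pos e
  have hflux :
      (fun t => c e t * Γ.edgeDeriv x e t) =ᵐ[volume.restrict (Ioo 0 (Γ.length e))] w e := by
    filter_upwards [hx e, ae_restrict_mem measurableSet_Ioo] with t hxt ht
    rw [hxt, hwc e t (Ioo_subset_Icc_self ht)]
  rw [← (hy e).1, ← (hy e).2, ← hwc e 0 (left_mem_Icc.mpr hl.le),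
    ← hwc e _ (right_mem_Icc.mpr hl.le)]
  exact green_interval hl (hp e) (isH1_rep x.1 e).memLp (isH1_rep y.1 e) (hw e) hflux (hh e)

end Form

end MetricGraph

/-! ### The operator and its form -/

namespace MetricGraph

variable {V : Type*} {G : SimpleGraph V} (Γ : MetricGraph G)

theorem exists_formDomain_vertex_values (φ : V → ℝ) :
    ∃ y : Γ.formDomain, ∀ e,
      rep y.1 e 0 = φ (Γ.src e) ∧ rep y.1 e (Γ.length e) = φ (Γ.tgt e) := by
  let slope : G.edgeSet → ℝ := fun e => (φ (Γ.tgt e) - φ (Γ.src e)) / Γ.length e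
  let u : G.edgeSet → ℝ → ℝ := fun e t => φ (Γ.src e) + slope e * t
  have hu : ∀ e, IsH1 (Γ.length e) (u e) fun _ => slope e := fun e =>
    IsH1.of_hasDerivAt (fun t => by
      simpa only [id, mul_one] using
        ((hasDerivAt_id t).const_mul (slope e)).const_add (φ (Γ.src e)))
      continuous_const
  have hval : ∀ e, u e 0 = φ (Γ.src e) ∧ u e (Γ.length e) = φ (Γ.tgt e) := by
    intro e
    have hl := (Γ.length_pos e).ne'
    refine ⟨by simp only [u, mul_zero, add_zero], ?_⟩
    simp only [u, slope]
    field_simp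
    ring
  refine ⟨Γ.domainOfIsH1 hu (Γ.vertexContinuous_of_vertex_values hval), fun e => ?_⟩
  have hl := (Γ.length_pos e).le
  exact ⟨(rep_ofIsH1 hu e (left_mem_Icc.mpr hl)).trans (hval e).1,
    (rep_ofIsH1 hu e (right_mem_Icc.mpr hl)).trans (hval e).2⟩

section SingleEdge

variable [DecidableEq G.edgeSet] {e : G.edgeSet} {φ φ' : ℝ → ℝ}

theorem isH1_single (hφ : IsH1 (Γ.length e) φ φ') (e' : G.edgeSet) :
    IsH1 (Γ.length e') (Pi.single (M := fun _ => ℝ → ℝ) e φ e')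
      (Pi.single (M := fun _ => ℝ → ℝ) e φ' e') := by
  rcases eq_or_ne e' e with rfl | hne
  · simpa only [Pi.single_eq_same] using hφ
  · simpa only [Pi.single_eq_of_ne hne] using IsH1.zero _

theorem vertexContinuous_single (hφ0 : φ 0 = 0) (hφl : φ (Γ.length e) = 0) :
    Γ.VertexContinuous (Pi.single (M := fun _ => ℝ → ℝ) e φ) := by
  refine Γ.vertexContinuous_of_vertex_values (φ := 0) fun e' => ?_
  rcases eq_or_ne e' e with rfl | hne
  · simp only [Pi.single_eq_same, hφ0, hφl, Pi.zero_apply, and_self]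
  · simp only [Pi.single_eq_of_ne hne, Pi.zero_apply, and_self]

end SingleEdge

variable [Fintype G.edgeSet]

section DomainOfIsH1

variable {u u' : G.edgeSet → ℝ → ℝ} (hu : ∀ e, IsH1 (Γ.length e) (u e) (u' e))
  (huv : Γ.VertexContinuous u)

theorem embed_domainOfIsH1_ae_eq (e : G.edgeSet) :
    Γ.embed (Γ.domainOfIsH1 hu huv) e =ᵐ[volume.restrict (Ioo 0 (Γ.length e))] u e :=
  (Γ.embed_ae_eq _ e).trans (rep_ofIsH1_ae_eq hu e)

theorem inner_embed_domainOfIsH1 (f : Γ.StateSpace) :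
    inner ℝ f (Γ.embed (Γ.domainOfIsH1 hu huv)) =
      ∑ e, ∫ t in Ioo 0 (Γ.length e), f e t * u e t := by
  rw [inner_eq_sum]
  refine Finset.sum_congr rfl fun e _ => integral_congr_ae ?_
  filter_upwards [Γ.embed_domainOfIsH1_ae_eq hu huv e] with t ht
  rw [ht]

end DomainOfIsH1

section WeakStrong

variable {c p : G.edgeSet → ℝ → ℝ}
  (hc : ∀ e, MemLp (c e) ⊤ (volume.restrict (Ioo 0 (Γ.length e))))
  (hp : ∀ e, MemLp (p e) ⊤ (volume.restrict (Ioo 0 (Γ.length e))))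

theorem form_domainOfIsH1 {u u' : G.edgeSet → ℝ → ℝ}
    (hu : ∀ e, IsH1 (Γ.length e) (u e) (u' e)) (huv : Γ.VertexContinuous u) (x : Γ.formDomain) :
    Γ.form hc hp x (Γ.domainOfIsH1 hu huv) =
      ∑ e, ((∫ t in Ioo 0 (Γ.length e), c e t * Γ.edgeDeriv x e t * u' e t) +
        ∫ t in Ioo 0 (Γ.length e), p e t * rep x.1 e t * u e t) := by
  rw [form_eq_sum]
  refine Finset.sum_congr rfl fun e _ => ?_
  congr 1 <;> refine integral_congr_ae ?_
  · filter_upwards [Γ.edgeDeriv_domainOfIsH1_ae_eq hu huv e] with t ht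
    rw [ht]
  · filter_upwards [rep_ofIsH1_ae_eq hu e] with t ht
    rw [← ht]
    rfl

theorem OperatorRel.weakRel {Γ : MetricGraph G}
    (hc : ∀ e, MemLp (c e) ⊤ (volume.restrict (Ioo 0 (Γ.length e))))
    (hp : ∀ e, MemLp (p e) ⊤ (volume.restrict (Ioo 0 (Γ.length e)))) {f h : Γ.StateSpace}
    (hA : Γ.OperatorRel c p f h) :
    WeakRel (E := Γ.formDomain) (Γ.form hc hp) Γ.embed f h := by
  classical
  obtain ⟨u, u', w, w', hf, hu, hw, hwc, huv, hkirchhoff, hh⟩ := hA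
  refine ⟨Γ.domainOfIsH1 hu huv, ?_, fun y => ?_⟩
  · ext1 e
    exact Lp.ext ((Γ.embed_domainOfIsH1_ae_eq hu huv e).trans (hf e).symm)
  · obtain ⟨φ, hφ⟩ := (Γ.mem_formDomain.mp y.2).exists_vertex_values
    let S : Finset V := Finset.univ.image Γ.src ∪ Finset.univ.image Γ.tgt
    have hS : ∀ e, Γ.src e ∈ S ∧ Γ.tgt e ∈ S := by simp [S]
    rw [Γ.form_eq_neg_inner_sub_sum_netFlux hc hp (Γ.edgeDeriv_domainOfIsH1_ae_eq hu huv) hw hwc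
      (fun e => ?_) hφ hS, sub_eq_self]
    · refine Finset.sum_eq_zero fun v _ => ?_
      rw [netFlux, hkirchhoff v, mul_zero]
    · filter_upwards [hh e, rep_ofIsH1_ae_eq hu e] with t ht hrep
      rw [ht, ← hrep]
      rfl

theorem exists_flux_of_form_eq {x : Γ.formDomain} {h : Γ.StateSpace}
    (hx : ∀ y, Γ.form hc hp x y = -inner ℝ h (Γ.embed y)) (e : G.edgeSet) :
    ∃ w, IsH1 (Γ.length e) w (fun t => h e t + p e t * rep x.1 e t) ∧
      (fun t => c e t * Γ.edgeDeriv x e t) =ᵐ[volume.restrict (Ioo 0 (Γ.length e))] w := by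
  classical
  have hrep : MemLp (rep x.1 e) 2 (volume.restrict (Ioo 0 (Γ.length e))) :=
    (isH1_rep x.1 e).memLp
  refine exists_isH1_ae_eq_of_weak_deriv (Γ.length_pos e) ((Lp.memLp _).mul (hc e))
    ((Lp.memLp (h e)).add (hrep.mul (hp e))) fun φ φ' hφ hφ0 hφl => ?_
  have htest := hx (Γ.domainOfIsH1 (Γ.isH1_single hφ) (Γ.vertexContinuous_single hφ0 hφl))
  rw [form_domainOfIsH1, inner_embed_domainOfIsH1, Finset.sum_eq_single e,
    Finset.sum_eq_single e] at htest
  · have hint : IntegrableOn (fun t => h e t * φ t) (Ioo 0 (Γ.length e)) :=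
      (Lp.memLp (h e)).integrable_mul hφ.memLp
    simp only [Pi.single_eq_same] at htest
    simp only [add_mul]
    rw [integral_add hint (integrableOn_mul_mul (hp e) hrep hφ.memLp)]
    linarith
  all_goals simp +contextual [Pi.single_eq_of_ne]

theorem netFlux_eq_zero_of_form_eq {x : Γ.formDomain} {h : Γ.StateSpace}
    {u' w w' : G.edgeSet → ℝ → ℝ}
    (hform : ∀ y, Γ.form hc hp x y = -inner ℝ h (Γ.embed y))
    (hx : ∀ e, Γ.edgeDeriv x e =ᵐ[volume.restrict (Ioo 0 (Γ.length e))] u' e)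
    (hw : ∀ e, IsH1 (Γ.length e) (w e) (w' e))
    (hwc : ∀ e, ∀ t ∈ Icc 0 (Γ.length e), w e t = c e t * u' e t)
    (hh : ∀ e, h e =ᵐ[volume.restrict (Ioo 0 (Γ.length e))]
      fun t => w' e t - p e t * rep x.1 e t) (v : V) : Γ.netFlux c u' v = 0 := by
  classical
  obtain ⟨y, hy⟩ := Γ.exists_formDomain_vertex_values (Pi.single v 1)
  let S : Finset V := insert v (Finset.univ.image Γ.src ∪ Finset.univ.image Γ.tgt)
  have hS : ∀ e, Γ.src e ∈ S ∧ Γ.tgt e ∈ S := by simp [S]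
  have hgreen := Γ.form_eq_neg_inner_sub_sum_netFlux hc hp hx hw hwc hh hy hS
  rw [hform y, eq_comm, sub_eq_self, Finset.sum_eq_single v] at hgreen
  · simpa only [Pi.single_eq_same, one_mul] using hgreen
  · intro v' _ hne
    rw [Pi.single_eq_of_ne hne, zero_mul]
  · simp [S]

theorem operatorRel_iff_weakRel (hc0 : ∀ e, ∀ t ∈ Icc 0 (Γ.length e), c e t ≠ 0)
    {f h : Γ.StateSpace} :
    Γ.OperatorRel c p f h ↔
      WeakRel (E := Γ.formDomain) (Γ.form hc hp) Γ.embed f h := by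
  refine ⟨OperatorRel.weakRel hc hp, ?_⟩
  rintro ⟨x, rfl, hx⟩
  choose w hw hflux using Γ.exists_flux_of_form_eq hc hp hx
  let u' : G.edgeSet → ℝ → ℝ := fun e t => w e t / c e t
  have hwc : ∀ e, ∀ t ∈ Icc 0 (Γ.length e), w e t = c e t * u' e t := fun e t ht =>
    (mul_div_cancel₀ _ (hc0 e t ht)).symm
  have hderiv : ∀ e, Γ.edgeDeriv x e =ᵐ[volume.restrict (Ioo 0 (Γ.length e))] u' e := by
    intro e
    filter_upwards [hflux e, ae_restrict_mem measurableSet_Ioo] with t hflux_t ht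
    exact mul_left_cancel₀ (hc0 e t (Ioo_subset_Icc_self ht))
      (hflux_t.trans (hwc e t (Ioo_subset_Icc_self ht)))
  have hh : ∀ e, h e =ᵐ[volume.restrict (Ioo 0 (Γ.length e))]
      fun t => (h e t + p e t * rep x.1 e t) - p e t * rep x.1 e t := fun e =>
    Filter.Eventually.of_forall fun t => (add_sub_cancel_right _ _).symm
  have hrep : ∀ e, IsH1 (Γ.length e) (rep x.1 e) (u' e) := fun e =>
    ⟨(memLp_congr_ae (hderiv e)).mp (Lp.memLp _), fun t ht => by
      rw [← intervalIntegral_congr_of_ae (hderiv e) ht]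
      exact (isH1_rep x.1 e).2 t ht⟩
  exact ⟨rep x.1, u', w, _, Γ.embed_ae_eq x, hrep, hw, hwc, Γ.mem_formDomain.mp x.2,
    Γ.netFlux_eq_zero_of_form_eq hc hp hx hderiv hw hwc hh, hh⟩

end WeakStrong

end MetricGraph

/-! ### Approximation and test spaces -/

theorem norm_sum_smul_sq_of_orthogonal {ι H : Type*} [Fintype ι] [DecidableEq ι]
    [NormedAddCommGroup H] [InnerProductSpace ℝ H] {v : ι → H} {α : ι → ℝ}
    (hv : ∀ i j, inner ℝ (v i) (v j) = if i = j then α i else 0) (s : ι → ℝ) :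
    ‖∑ i, s i • v i‖ ^ 2 = ∑ i, s i ^ 2 * α i := by
  rw [← real_inner_self_eq_norm_sq, sum_inner]
  refine Finset.sum_congr rfl fun i _ => ?_
  simp only [inner_sum, real_inner_smul_left, real_inner_smul_right, hv, mul_ite, mul_zero,
    Finset.sum_ite_eq, Finset.mem_univ, if_true]
  ring

namespace MetricGraph

variable {V : Type*} {G : SimpleGraph V} (Γ : MetricGraph G)

section SineMode

variable [DecidableEq G.edgeSet] (e : G.edgeSet)

/-- The `i`-th Dirichlet eigenfunction of the edge `e`, extended by zero to the other edges. It
vanishes at every vertex, so that it belongs to the form domain. -/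
noncomputable def sineMode (i : ℕ) : Γ.formDomain :=
  Γ.domainOfIsH1 (Γ.isH1_single (e := e) (isH1_sin _ (dirichletFreq (Γ.length e) i)))
    (Γ.vertexContinuous_single (by rw [mul_zero, Real.sin_zero])
      (sin_dirichletFreq_mul_self (Γ.length_pos e) i))

theorem edgeDeriv_sineMode_ae_eq (i : ℕ) (e' : G.edgeSet) :
    Γ.edgeDeriv (Γ.sineMode e i) e' =ᵐ[volume.restrict (Ioo 0 (Γ.length e'))]
      Pi.single (M := fun _ => ℝ → ℝ) e (fun t =>
        dirichletFreq (Γ.length e) i * Real.cos (dirichletFreq (Γ.length e) i * t)) e' :=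
  Γ.edgeDeriv_domainOfIsH1_ae_eq _ _ e'

variable [Fintype G.edgeSet]

theorem embed_sineMode_ae_eq (i : ℕ) (e' : G.edgeSet) :
    Γ.embed (Γ.sineMode e i) e' =ᵐ[volume.restrict (Ioo 0 (Γ.length e'))]
      Pi.single (M := fun _ => ℝ → ℝ) e (fun t => Real.sin (dirichletFreq (Γ.length e) i * t)) e' :=
  Γ.embed_domainOfIsH1_ae_eq _ _ e'

variable {e} in
theorem inner_eq_integral_of_ae_eq_single {f g : Γ.StateSpace} {φ ψ : ℝ → ℝ}
    (hf : ∀ e', f e' =ᵐ[volume.restrict (Ioo 0 (Γ.length e'))]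
      Pi.single (M := fun _ => ℝ → ℝ) e φ e')
    (hg : ∀ e', g e' =ᵐ[volume.restrict (Ioo 0 (Γ.length e'))]
      Pi.single (M := fun _ => ℝ → ℝ) e ψ e') :
    inner ℝ f g = ∫ t in Ioo 0 (Γ.length e), φ t * ψ t := by
  rw [inner_eq_sum, Finset.sum_eq_single e]
  · refine integral_congr_ae ?_
    filter_upwards [hf e, hg e] with t hft hgt
    rw [hft, hgt, Pi.single_eq_same, Pi.single_eq_same]
  · intro e' _ hne
    refine integral_eq_zero_of_ae ?_
    filter_upwards [hf e'] with t hft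
    rw [hft, Pi.single_eq_of_ne hne, Pi.zero_apply, zero_mul]
  · exact fun h => absurd (Finset.mem_univ e) h

theorem inner_embed_sineMode (i j : ℕ) :
    inner ℝ (Γ.embed (Γ.sineMode e i)) (Γ.embed (Γ.sineMode e j)) =
      if i = j then Γ.length e / 2 else 0 := by
  rw [Γ.inner_eq_integral_of_ae_eq_single (Γ.embed_sineMode_ae_eq e i)
    (Γ.embed_sineMode_ae_eq e j), integral_sin_mul_sin (Γ.length_pos e)]

theorem inner_edgeDeriv_sineMode (i j : ℕ) :
    inner ℝ (Γ.edgeDeriv (Γ.sineMode e i)) (Γ.edgeDeriv (Γ.sineMode e j)) =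
      if i = j then dirichletFreq (Γ.length e) i ^ 2 * (Γ.length e / 2) else 0 := by
  rw [Γ.inner_eq_integral_of_ae_eq_single (Γ.edgeDeriv_sineMode_ae_eq e i)
    (Γ.edgeDeriv_sineMode_ae_eq e j)]
  simp only [mul_mul_mul_comm, integral_const_mul, integral_cos_mul_cos (Γ.length_pos e)]
  split_ifs with hij
  · rw [hij, sq]
  · rw [mul_zero]

end SineMode

variable [Fintype G.edgeSet]

theorem exists_test_space (e : G.edgeSet) (n : ℕ) :
    ∃ b : (Fin n → ℝ) →ₗ[ℝ] Γ.formDomain, (∀ s, Γ.embed (b s) = 0 → s = 0) ∧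
      ∀ s, ‖Γ.edgeDeriv (b s)‖ ^ 2 ≤
        (Real.pi / Γ.length e) ^ 2 * (n : ℝ) ^ 2 * ‖Γ.embed (b s)‖ ^ 2 := by
  classical
  have hl := Γ.length_pos e
  let b : (Fin n → ℝ) →ₗ[ℝ] Γ.formDomain :=
    Fintype.linearCombination ℝ fun i : Fin n => Γ.sineMode e i
  have hembed : ∀ s, ‖Γ.embed (b s)‖ ^ 2 = ∑ i, s i ^ 2 * (Γ.length e / 2) := by
    intro s
    simp only [b, Fintype.linearCombination_apply, map_sum, map_smul]
    refine norm_sum_smul_sq_of_orthogonal (fun i j => ?_) s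
    simp only [inner_embed_sineMode, Fin.val_inj]
  have hderiv : ∀ s, ‖Γ.edgeDeriv (b s)‖ ^ 2 =
      ∑ i, s i ^ 2 * (dirichletFreq (Γ.length e) i ^ 2 * (Γ.length e / 2)) := by
    intro s
    simp only [b, Fintype.linearCombination_apply, map_sum, map_smul]
    refine norm_sum_smul_sq_of_orthogonal (fun i j => ?_) s
    simp only [inner_edgeDeriv_sineMode, Fin.val_inj]
  have hfreq : ∀ i : Fin n,
      dirichletFreq (Γ.length e) i ^ 2 ≤ (Real.pi / Γ.length e) ^ 2 * (n : ℝ) ^ 2 := by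
    intro i
    have hi : ((i : ℕ) : ℝ) + 1 ≤ n := by exact_mod_cast i.2
    rw [dirichletFreq, mul_pow, mul_comm]
    gcongr
  refine ⟨b, fun s hs => ?_, fun s => ?_⟩
  · have hsum := hembed s
    rw [hs, norm_zero, zero_pow two_ne_zero, eq_comm,
      Finset.sum_eq_zero_iff_of_nonneg fun i _ => by positivity] at hsum
    funext i
    exact pow_eq_zero_iff two_ne_zero |>.mp
      ((mul_eq_zero_iff_right (half_pos hl).ne').mp (hsum i (Finset.mem_univ i)))
  · rw [hembed, hderiv, Finset.mul_sum]
    refine Finset.sum_le_sum fun i _ => ?_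
    rw [mul_left_comm]
    gcongr
    exact hfreq i

theorem exists_vanishing_functional {n : ℕ} (hn : 0 < n) :
    ∃ Φ : Γ.formDomain →L[ℝ] (Fin (Fintype.card G.edgeSet * n) → ℝ), ∀ x, Φ x = 0 →
      (n : ℝ) ^ 2 * ‖Γ.embed x‖ ^ 2 ≤ (∑ e, Γ.length e ^ 2) * ‖Γ.edgeDeriv x‖ ^ 2 := by
  let σ : G.edgeSet × Fin n ≃ Fin (Fintype.card G.edgeSet * n) :=
    Fintype.equivFinOfCardEq (by simp)
  let node : G.edgeSet → ℕ → ℝ := fun e j => j * (Γ.length e / n)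
  have node_mem : ∀ e, ∀ j < n, node e j ∈ Icc 0 (Γ.length e) := by
    intro e j hj
    have hl := Γ.length_pos e
    refine ⟨by positivity, ?_⟩
    simp only [node]
    rw [mul_div_assoc', div_le_iff₀ (by exact_mod_cast hn), mul_comm]
    gcongr
  refine ⟨ContinuousLinearMap.pi fun i =>
    (Γ.evalAt (σ.symm i).1 (node (σ.symm i).1 (σ.symm i).2)).comp Γ.formDomain.subtypeL,
    fun x hx => ?_⟩
  have hzero : ∀ e, ∀ j < n, rep x.1 e (node e j) = 0 := by
    intro e j hj
    rw [← Γ.evalAt_apply e (node_mem e j hj)]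
    simpa only [ContinuousLinearMap.coe_pi', ContinuousLinearMap.comp_apply,
      Submodule.subtypeL_apply, Equiv.symm_apply_apply, Pi.zero_apply]
      using congrFun hx (σ (e, ⟨j, hj⟩))
  rw [norm_sq_eq_sum, norm_sq_eq_sum, Finset.mul_sum, Finset.mul_sum]
  refine Finset.sum_le_sum fun e _ => ?_
  have hembed : ∫ t in Ioo 0 (Γ.length e), Γ.embed x e t ^ 2 =
      ∫ t in Ioo 0 (Γ.length e), rep x.1 e t ^ 2 :=
    integral_congr_ae ((Γ.embed_ae_eq x e).fun_comp (· ^ 2))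
  have hlength : Γ.length e ^ 2 ≤ ∑ e, Γ.length e ^ 2 :=
    Finset.single_le_sum (f := fun e => Γ.length e ^ 2) (fun e _ => sq_nonneg _)
      (Finset.mem_univ e)
  rw [hembed]
  exact ((isH1_rep x.1 e).sq_mul_integral_sq_le (Γ.length_pos e) hn (hzero e)).trans
    (mul_le_mul_of_nonneg_right hlength (integral_nonneg fun t => sq_nonneg _))

theorem exists_norm_embed_le_of_eq_zero {ε : ℝ} (hε : 0 < ε) :
    ∃ (N : ℕ) (Φ : Γ.formDomain →L[ℝ] (Fin N → ℝ)), ∀ x, Φ x = 0 → ‖Γ.embed x‖ ≤ ε * ‖x‖ := by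
  let L := ∑ e, Γ.length e ^ 2
  obtain ⟨n, hn⟩ := exists_nat_gt (Real.sqrt L / ε)
  have hn0 : (0 : ℝ) < n := lt_of_le_of_lt (by positivity) hn
  obtain ⟨Φ, hΦ⟩ := Γ.exists_vanishing_functional (n := n) (by exact_mod_cast hn0)
  refine ⟨_, Φ, fun x hx => ?_⟩
  have hderiv : ‖Γ.edgeDeriv x‖ ≤ ‖x‖ := WithLp.norm_snd_le _ x.1
  have hL : L ≤ (n * ε) ^ 2 :=
    (Real.sqrt_le_left (by positivity)).mp ((div_lt_iff₀ hε).mp hn).le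
  have hsq : (n : ℝ) ^ 2 * ‖Γ.embed x‖ ^ 2 ≤ n ^ 2 * (ε * ‖x‖) ^ 2 := by
    calc (n : ℝ) ^ 2 * ‖Γ.embed x‖ ^ 2 ≤ L * ‖Γ.edgeDeriv x‖ ^ 2 := hΦ x hx
      _ ≤ (n * ε) ^ 2 * ‖x‖ ^ 2 := by gcongr
      _ = n ^ 2 * (ε * ‖x‖) ^ 2 := by ring
  exact (sq_le_sq₀ (norm_nonneg _) (by positivity)).mp
    (le_of_mul_le_mul_left hsq (by positivity))

theorem isCompactOperator_embed : IsCompactOperator Γ.embed :=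
  (isCompactOperator_of_small_on_finite_codim (H := Γ.formDomain) Γ.embed
    fun _ hε => Γ.exists_norm_embed_le_of_eq_zero hε :)

end MetricGraph

/-! ### The eigenvalues -/

theorem le_of_ae_le_of_continuousOn {l : ℝ} (hl : 0 < l) {c : ℝ → ℝ} {c₀ : ℝ}
    (hc : ContinuousOn c (Icc 0 l))
    (h : ∀ᵐ x ∂(volume.restrict (Ioo 0 l)), c₀ ≤ c x) : ∀ t ∈ Icc 0 l, c₀ ≤ c t := by
  have hmin : ContinuousOn (fun t => min c₀ (c t)) (Icc 0 l) := continuousOn_const.inf hc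
  have hIoo : EqOn (fun t => min c₀ (c t)) (fun _ => c₀) (Ioo 0 l) :=
    Measure.eqOn_open_of_ae_eq (h.mono fun t ht => min_eq_left ht) isOpen_Ioo
      (hmin.mono Ioo_subset_Icc_self) continuousOn_const
  have hIcc : EqOn (fun t => min c₀ (c t)) (fun _ => c₀) (Icc 0 l) :=
    hIoo.of_subset_closure hmin continuousOn_const Ioo_subset_Icc_self
      (closure_Ioo hl.ne).ge
  exact fun t ht => min_eq_left_iff.mp (hIcc ht)

namespace MetricGraph

variable {V : Type*} {G : SimpleGraph V} (Γ : MetricGraph G) {c p : G.edgeSet → ℝ → ℝ}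
  {eig : ℕ → ℝ}

theorem not_finiteDimensional_stateSpace [Finite G.edgeSet] [Nonempty G.edgeSet] :
    ¬ FiniteDimensional ℝ Γ.StateSpace := by
  have := Fintype.ofFinite G.edgeSet
  obtain ⟨e⟩ := ‹Nonempty G.edgeSet›
  refine (not_finiteDimensional_of_test (E := Γ.formDomain) Γ.embed fun n => ?_ :)
  obtain ⟨b, hb, -⟩ := Γ.exists_test_space e n
  exact ⟨b, hb⟩

variable [Fintype G.edgeSet]

theorem isEigenvalueSequence_iff :
    Γ.IsEigenvalueSequence c p eig ↔ Antitone eig ∧ ∃ f : HilbertBasis ℕ ℝ Γ.StateSpace,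
      ∀ k, Γ.OperatorRel c p (f k) (eig k • f k) := by
  refine and_congr_right fun _ => exists_congr fun f => forall_congr' fun k => ?_
  rw [← Γ.mem_operator_graph_iff, LinearPMap.mem_graph_iff]
  refine ⟨fun ⟨hk, heigen⟩ => ⟨⟨f k, hk⟩, rfl, heigen⟩, ?_⟩
  rintro ⟨⟨y, hy⟩, hyf, heigen⟩
  obtain rfl : y = f k := hyf
  exact ⟨hy, heigen⟩

theorem denseRange_embed : DenseRange Γ.embed := by
  have hrange : Γ.embed.range.topologicalClosure = ⊤ := by
    rw [Submodule.topologicalClosure_eq_top_iff, Submodule.eq_bot_iff]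
    intro h hh
    -- `h` is orthogonal to the range iff `A 0 = h`, for the Laplacian `c = 1`, `p = 0`.
    have hrel : Γ.OperatorRel (fun _ _ => 1) (fun _ _ => 0) 0 h := by
      refine (Γ.operatorRel_iff_weakRel (fun e => memLp_const 1) (fun e => MemLp.zero')
        fun _ _ _ => one_ne_zero).mpr ⟨0, map_zero _, fun y => ?_⟩
      have horthogonal : inner ℝ h (Γ.embed y) = 0 :=
        (Submodule.mem_orthogonal' _ h).mp hh _ (LinearMap.mem_range_self _ y)
      rw [map_zero, zero_apply, horthogonal, neg_zero]
    exact Γ.operatorRel_unique _ _ hrel (Γ.operatorGraph _ _).zero_mem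
  exact Submodule.dense_iff_topologicalClosure_eq_top.mpr hrange

section Spectrum

variable {Γ} {c₀ : ℝ} (hc : ∀ e, MemLp (c e) ⊤ (volume.restrict (Ioo 0 (Γ.length e))))
  (hp : ∀ e, MemLp (p e) ⊤ (volume.restrict (Ioo 0 (Γ.length e))))

include hc hp

theorem IsEigenvalueSequence.exists_weakRel (heig : Γ.IsEigenvalueSequence c p eig) :
    ∃ f : HilbertBasis ℕ ℝ Γ.StateSpace, ∀ k,
      WeakRel (E := Γ.formDomain) (Γ.form hc hp) Γ.embed (f k) (eig k • f k) := by
  obtain ⟨-, f, hrel⟩ := Γ.isEigenvalueSequence_iff.mp heig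
  exact ⟨f, fun k => (hrel k).weakRel hc hp⟩

variable (hc₀ : 0 < c₀)
  (hcpos : ∀ e, ∀ᵐ t ∂(volume.restrict (Ioo 0 (Γ.length e))), c₀ ≤ c e t)
  (hpnonneg : ∀ e, ∀ᵐ t ∂(volume.restrict (Ioo 0 (Γ.length e))), 0 ≤ p e t)

include hc₀ hcpos hpnonneg

theorem form_self_nonneg (x : Γ.formDomain) : 0 ≤ Γ.form hc hp x x :=
  (mul_nonneg hc₀.le (sq_nonneg _)).trans
    (Γ.mul_norm_edgeDeriv_sq_le_form hc hp hcpos hpnonneg x)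

theorem exists_isEigenvalueSequence [Nonempty G.edgeSet]
    (hc0 : ∀ e, ∀ t ∈ Icc 0 (Γ.length e), c e t ≠ 0) :
    ∃ eig : ℕ → ℝ, Γ.IsEigenvalueSequence c p eig := by
  have spectral := exists_weak_eigenbasis (E := Γ.formDomain) (a := Γ.form hc hp) (J := Γ.embed)
    Γ.not_finiteDimensional_stateSpace
  obtain ⟨f, eig, hanti, hweak⟩ := spectral (Γ.form_symm hc hp)
    (Γ.exists_coercive hc hp hc₀ hcpos hpnonneg) Γ.isCompactOperator_embed Γ.denseRange_embed
  exact ⟨eig, Γ.isEigenvalueSequence_iff.mpr ⟨hanti, f, fun k =>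
    (Γ.operatorRel_iff_weakRel hc hp hc0).mpr (hweak k)⟩⟩

namespace IsEigenvalueSequence

theorem neg_nonneg (heig : Γ.IsEigenvalueSequence c p eig) (k : ℕ) : 0 ≤ -eig k := by
  obtain ⟨f, hweak⟩ := heig.exists_weakRel hc hp
  have nonpos_of_weakRel := WeakRel.eigenvalue_nonpos (E := Γ.formDomain) (a := Γ.form hc hp)
    (J := Γ.embed)
  exact Left.nonneg_neg_iff.mpr (nonpos_of_weakRel
    (form_self_nonneg hc hp hc₀ hcpos hpnonneg) (f.orthonormal.ne_zero k) (hweak k))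

theorem sq_le_mul_neg [Nonempty G.edgeSet] (heig : Γ.IsEigenvalueSequence c p eig)
    {n k : ℕ} (hn : 0 < n) (hnk : Fintype.card G.edgeSet * n ≤ k) :
    (n : ℝ) ^ 2 ≤ (∑ e, Γ.length e ^ 2) / c₀ * -eig k := by
  obtain ⟨f, hweak⟩ := heig.exists_weakRel hc hp
  obtain ⟨Φ, hΦ⟩ := Γ.exists_vanishing_functional hn
  have hL : 0 < ∑ e, Γ.length e ^ 2 :=
    Finset.sum_pos (fun e _ => pow_pos (Γ.length_pos e) 2) Finset.univ_nonempty
  have hform : ∀ x, Φ x = 0 →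
      (n : ℝ) ^ 2 / ((∑ e, Γ.length e ^ 2) / c₀) * ‖Γ.embed x‖ ^ 2 ≤ Γ.form hc hp x x := by
    intro x hx
    refine le_trans ?_ (Γ.mul_norm_edgeDeriv_sq_le_form hc hp hcpos hpnonneg x)
    rw [div_mul_eq_mul_div, div_le_iff₀ (div_pos hL hc₀)]
    refine (hΦ x hx).trans_eq ?_
    field_simp
  have min_max := le_neg_eigenvalue_of_codim_le (E := Γ.formDomain) (a := Γ.form hc hp)
    (J := Γ.embed) (W := Fin (Fintype.card G.edgeSet * n) → ℝ) (f := f)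
  rw [← div_le_iff₀' (div_pos hL hc₀)]
  exact min_max f.orthonormal heig.1 hweak Φ (by simpa using hnk) hform

theorem exists_neg_le [Nonempty G.edgeSet] (heig : Γ.IsEigenvalueSequence c p eig) :
    ∃ C ≥ 0, ∀ k : ℕ, -eig k ≤ C * ((k : ℝ) + 1) ^ 2 := by
  obtain ⟨f, hweak⟩ := heig.exists_weakRel hc hp
  obtain ⟨e⟩ := ‹Nonempty G.edgeSet›
  obtain ⟨K, hK, hform⟩ := Γ.exists_form_self_le hc hp
  refine ⟨K * ((Real.pi / Γ.length e) ^ 2 + 1), by positivity, fun k => ?_⟩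
  obtain ⟨b, hb, hderiv⟩ := Γ.exists_test_space e (k + 1)
  have min_max := neg_eigenvalue_le_of_lt_finrank (E := Γ.formDomain) (a := Γ.form hc hp)
    (J := Γ.embed) (W := Fin (k + 1) → ℝ)
  refine min_max (form_self_nonneg hc hp hc₀ hcpos hpnonneg) (Γ.form_symm hc hp) f heig.1 hweak b
    (by simp) hb fun s => (hform (b s)).trans ?_
  have hk : (1 : ℝ) ≤ ((k : ℝ) + 1) ^ 2 :=
    one_le_pow₀ (le_add_of_nonneg_left k.cast_nonneg)
  have hembed : ‖Γ.embed (b s)‖ ^ 2 ≤ ((k : ℝ) + 1) ^ 2 * ‖Γ.embed (b s)‖ ^ 2 :=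
    le_mul_of_one_le_left (sq_nonneg _) hk
  have hderiv_s := hderiv s
  push_cast at hderiv_s
  rw [mul_assoc, mul_assoc]
  refine mul_le_mul_of_nonneg_left ?_ hK
  linarith

theorem exists_quadratic_bounds [Nonempty G.edgeSet] (heig : Γ.IsEigenvalueSequence c p eig)
    {lam : ℝ} (hlam : 0 < lam) :
    ∃ l₁ l₂ : ℝ, 0 < l₁ ∧ 0 < l₂ ∧ ∀ k : ℕ,
      l₁ * ((k : ℝ) + 1) ^ 2 ≤ lam - eig k ∧ lam - eig k ≤ l₂ * ((k : ℝ) + 1) ^ 2 := by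
  have hL : 0 < ∑ e, Γ.length e ^ 2 :=
    Finset.sum_pos (fun e _ => pow_pos (Γ.length_pos e) 2) Finset.univ_nonempty
  obtain ⟨l, hl, hlower⟩ := exists_mul_sq_le_add_of_sq_le
    (heig.neg_nonneg hc hp hc₀ hcpos hpnonneg) Fintype.card_pos (div_pos hL hc₀)
    (fun n k => heig.sq_le_mul_neg hc hp hc₀ hcpos hpnonneg) hlam
  obtain ⟨C, hC, hupper⟩ := heig.exists_neg_le hc hp hc₀ hcpos hpnonneg
  refine ⟨l, lam + C, hl, by positivity, fun k => ⟨hlower k, ?_⟩⟩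
  have hk : (1 : ℝ) ≤ ((k : ℝ) + 1) ^ 2 :=
    one_le_pow₀ (le_add_of_nonneg_left k.cast_nonneg)
  calc lam - eig k = lam + -eig k := sub_eq_add_neg _ _
    _ ≤ lam * ((k : ℝ) + 1) ^ 2 + C * ((k : ℝ) + 1) ^ 2 :=
      add_le_add (le_mul_of_one_le_right hlam.le hk) (hupper k)
    _ = (lam + C) * ((k : ℝ) + 1) ^ 2 := (add_mul _ _ _).symm

end IsEigenvalueSequence

end Spectrum

end MetricGraph

theorem mainTheorem6_general {V : Type*} (G : SimpleGraph V) [Fintype G.edgeSet]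
    [Nonempty G.edgeSet] (Γ : MetricGraph G) (c p : G.edgeSet → ℝ → ℝ)
    (hc : ∀ e, MemLp (c e) ⊤ (volume.restrict (Ioo 0 (Γ.length e))))
    (hc0 : ∀ e, ∀ t ∈ Icc 0 (Γ.length e), c e t ≠ 0) (c₀ : ℝ) (hc₀ : 0 < c₀)
    (hcpos : ∀ e, ∀ᵐ x ∂(volume.restrict (Ioo 0 (Γ.length e))), c₀ ≤ c e x)
    (hp : ∀ e, MemLp (p e) ⊤ (volume.restrict (Ioo 0 (Γ.length e))))
    (hpnonneg : ∀ e, ∀ᵐ x ∂(volume.restrict (Ioo 0 (Γ.length e))), 0 ≤ p e x) :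
    (∃ eig : ℕ → ℝ, Γ.IsEigenvalueSequence c p eig) ∧
    ∀ eig : ℕ → ℝ, Γ.IsEigenvalueSequence c p eig →
      ∀ lam : ℝ, 0 < lam →
        ∃ l₁ l₂ : ℝ, 0 < l₁ ∧ 0 < l₂ ∧
          ∀ k : ℕ, l₁ * ((k : ℝ) + 1) ^ 2 ≤ lam - eig k ∧
            lam - eig k ≤ l₂ * ((k : ℝ) + 1) ^ 2 :=
  ⟨MetricGraph.exists_isEigenvalueSequence hc hp hc₀ hcpos hpnonneg hc0, fun _ heig _ hlam =>
    heig.exists_quadratic_bounds hc hp hc₀ hcpos hpnonneg hlam⟩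

theorem mainTheorem6 {V : Type*} [Fintype V] (G : SimpleGraph V) [Fintype G.edgeSet]
    [Nonempty G.edgeSet] (Γ : MetricGraph G) (c p : G.edgeSet → ℝ → ℝ)
    (hc : ∀ e, ContinuousOn (c e) (Set.Icc 0 (Γ.length e)))
    (c₀ : ℝ) (hc₀ : 0 < c₀)
    (hcpos : ∀ e, ∀ᵐ x ∂(MeasureTheory.volume.restrict (Set.Ioo 0 (Γ.length e))), c₀ ≤ c e x)
    (hp : ∀ e, MeasureTheory.MemLp (p e) ⊤
      (MeasureTheory.volume.restrict (Set.Ioo 0 (Γ.length e))))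
    (hpnonneg : ∀ e, ∀ᵐ x ∂(MeasureTheory.volume.restrict (Set.Ioo 0 (Γ.length e))), 0 ≤ p e x) :
    (∃ eig : ℕ → ℝ, Γ.IsEigenvalueSequence c p eig) ∧
    ∀ eig : ℕ → ℝ, Γ.IsEigenvalueSequence c p eig →
      ∀ lam : ℝ, 0 < lam →
        ∃ l₁ l₂ : ℝ, 0 < l₁ ∧ 0 < l₂ ∧
          ∀ k : ℕ, l₁ * ((k : ℝ) + 1) ^ 2 ≤ lam - eig k ∧
            lam - eig k ≤ l₂ * ((k : ℝ) + 1) ^ 2 :=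
  mainTheorem6_general G Γ c p (fun e => memLp_of_continuousOn_Icc (hc e))
    (fun e t ht => (hc₀.trans_le
      (le_of_ae_le_of_continuousOn (Γ.length_pos e) (hc e) (hcpos e) t ht)).ne')
    c₀ hc₀ hcpos hp hpnonneg
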